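/- Let $K$ be a field of characteristic different from $2$ and $3$. A supervector space is a vector space $M=M_0\oplus M_1$ graded by $\mathbb Z/2$. An \emph{Akivis superalgebra} is a supervector space $M$ over $K$ with a bilinear map $[\,,]$ and a trilinear map $A$, both compatible with the $\mathbb Z/2$-grading (that is, $[M_\alpha,M_\beta]\subseteq M_{\alpha+\beta}$ and $A(M_\alpha,M_\beta,M_\gamma)\subseteq M_{\alpha+\beta+\gamma}$), such that for all homogeneous $x\in M_\alpha$, $y\in M_\beta$, $z\in M_\gamma$ one has $[x,y]=-(-1)^{\alpha\beta}[y,x]$ and $$[[x,y],z]+(-1)^{\alpha(\beta+\gamma)}[[y,z],x]+(-1)^{\gamma(\beta+\alpha)}[[z,x],y]=A(x,y,z)+(-1)^{\alpha(\beta+\gamma)}A(y,z,x)+(-1)^{\gamma(\beta+\alpha)}A(z,x,y)$$ $$-(-1)^{\alpha\beta}A(y,x,z)-(-1)^{\alpha(\beta+\gamma)+\beta\gamma}A(z,y,x)-(-1)^{\gamma\beta}A(x,z,y).$$ Let $\tilde T(M)=\bigoplus_{n\ge 0}\tilde T^n(M)$ be the nonassociative tensor algebra: $\tilde T^0(M)=K$,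 $\tilde T^1(M)=M$, $\tilde T^n(M)=\bigoplus_{i=1}^{n-1}\tilde T^i(M)\otimes\tilde T^{n-i}(M)$ for $n\ge2$, with product $xy=x\otimes y$ (elements of $K$ act as scalars) and the $\mathbb Z/2$-grading induced by that of $M$. The universal enveloping superalgebra of $M$ is $\tilde U(M)=\tilde T(M)/I$, where $I$ is the two-sided ideal generated by the elements $$x\otimes y-(-1)^{\alpha\beta}y\otimes x-[x,y],\qquad (x\otimes y)\otimes z-x\otimes(y\otimes z)-A(x,y,z)\qquad(x\in M_\alpha,\ y\in M_\beta,\ z\in M_\gamma),$$ and $\iota:M\to\tilde U(M)$ is the canonical map. Let $\tilde U_n(M)$ be the image of $\bigoplus_{i\le n}\tilde T^i(M)$ in $\tilde U(M)$, put $\tilde U_{-1}(M)=0$, and let $\operatorname{gr}\tilde U(M)=\bigoplus_{n\ge0}\tilde U_n(M)/\tilde U_{n-1}(M)$, with product $(a+\tilde U_{i-1}(M))(b+\tilde U_{j-1}(M))=ab+\tilde U_{i+j-1}(M)$ for $a\in\tilde U_i(M)$, $b\in\tilde U_j(M)$, and with the induced $\mathbb Z/2$-grading. Let $S(M)=\bigoplus_n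 S^n(M)$ be the supersymmetric superalgebra, the quotient of the associative tensor algebra of $M$ by the ideal generated by all $x\otimes y-(-1)^{\alpha\beta}y\otimes x$ with $x\in M_\alpha$, $y\in M_\beta$. Let $V(M)=\bigoplus_{n\ge0}V^n(M)$ be the nonassociative superalgebra with $V^n(M)=S^n(M)$ for $n\le3$ (where $S^0(M)=K$, $S^1(M)=M$) and $V^n(M)=\bigoplus_{i=1}^{n-1}V^i(M)\otimes V^{n-i}(M)$ for $n>3$; the product of $v\in V^i(M)$ and $w\in V^j(M)$ is their product in $S(M)$ if $i+j\le3$, and $v\otimes w$ if $i+j>3$ (multiplication by a scalar if $i=0$ or $j=0$); the $\mathbb Z/2$-grading is induced by that of $M$. \textbf{Theorem.} For every Akivis superalgebra $M$ over $K$, the $\mathbb Z$-graded superalgebras $V(M)$ and $\operatorname{gr}\tilde U(M)$ are isomorphic: there is a $K$-linear bijection $V(M)\to\operatorname{gr}\tilde U(M)$ which is multiplicative and unital, maps $V^n(M)$ onto $\tilde U_n(M)/\tilde U_{n-1}(M)$ for every $n$, preserves the $\mathbb Z/2$-grading, and sends each $m\in M=V^1(M)$ to the class of $\iota(m)$ in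 $\tilde U_1(M)/\tilde U_0(M)$. Moreover, $V(M)$ is the enveloping superalgebra of the trivial Akivis superalgebra $M^{\mathrm{triv}}$ on the supervector space $M$ (the one with $[\,,]=0$ and $A=0$): there is an isomorphism of superalgebras $V(M)\to\tilde U(M^{\mathrm{triv}})$ which is unital, maps $V^n(M)$ onto the image of $\tilde T^n(M)$ for every $n$, preserves the $\mathbb Z/2$-grading, and sends each $m\in M$ to its canonical image. -/

import Mathlib

open scoped TensorProduct DirectSum

universe u v w

namespace AkivisSuper

noncomputable section

/-- The sign `(-1)^γ` for `γ ∈ ℤ/2`. -/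
def sgn (K : Type u) [Ring K] (γ : ZMod 2) : K := (-1) ^ γ.val

/-! ### Akivis superalgebras -/

/-- An Akivis superalgebra structure on the `K`-vector space `M`: a `ℤ/2`-grading `M = M₀ ⊕ M₁`,
a bilinear superanticommutative bracket of degree `0`, and a trilinear map `A` of degree `0`,
linked by the super Akivis identity. -/
structure AkivisSuperalgebra (K : Type u) (M : Type v) [Field K] [AddCommGroup M] [Module K M] where
  /-- the subspaces `M₀` and `M₁` -/
  gr : ZMod 2 → Submodule K M
  isInternal : DirectSum.IsInternal gr
  /-- the binary operation `[x, y]` -/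
  bracket : M →ₗ[K] M →ₗ[K] M
  /-- the ternary operation `A(x, y, z)` -/
  A : M →ₗ[K] M →ₗ[K] M →ₗ[K] M
  bracket_mem : ∀ α β x y, x ∈ gr α → y ∈ gr β → bracket x y ∈ gr (α + β)
  A_mem : ∀ α β γ x y z, x ∈ gr α → y ∈ gr β → z ∈ gr γ → A x y z ∈ gr (α + β + γ)
  bracket_anticomm : ∀ α β x y, x ∈ gr α → y ∈ gr β →
    bracket x y = -(sgn K (α * β) • bracket y x)
  akivis : ∀ α β γ x y z, x ∈ gr α → y ∈ gr β → z ∈ gr γ →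
    bracket (bracket x y) z
        + sgn K (α * (β + γ)) • bracket (bracket y z) x
        + sgn K (γ * (β + α)) • bracket (bracket z x) y
      = A x y z
        + sgn K (α * (β + γ)) • A y z x
        + sgn K (γ * (β + α)) • A z x y
        - sgn K (α * β) • A y x z
        - sgn K (α * (β + γ) + β * γ) • A z y x
        - sgn K (γ * β) • A x z y

/-- The trivial Akivis superalgebra (`[ , ] = 0`, `A = 0`) on the supervector space of `X`. -/
def AkivisSuperalgebra.trivial {K : Type u} {M : Type v} [Field K] [AddCommGroup M] [Module K M]
    (X : AkivisSuperalgebra K M) : AkivisSuperalgebra K M where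
  gr := X.gr
  isInternal := X.isInternal
  bracket := 0
  A := 0
  bracket_mem := by intros; simp
  A_mem := by intros; simp
  bracket_anticomm := by intros; simp
  akivis := by intros; simp

/-! ### Bilinear maps out of direct sums and quotients -/

section Bilinear

variable {K : Type u} [Field K]

/-- The bilinear map on `⨁ Lᵢ` with given values on pairs of homogeneous elements. -/
def directSumBilin {L : ℕ → Type v} [∀ i, AddCommGroup (L i)] [∀ i, Module K (L i)]
    {P : Type w} [AddCommMonoid P] [Module K P] (f : ∀ i j, L i →ₗ[K] L j →ₗ[K] P) :
    (⨁ i, L i) →ₗ[K] (⨁ i, L i) →ₗ[K] P :=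
  DirectSum.toModule K ℕ _ fun i =>
    LinearMap.flip (DirectSum.toModule K ℕ _ fun j => LinearMap.flip (f i j))

theorem directSumBilin_lof {L : ℕ → Type v} [∀ i, AddCommGroup (L i)] [∀ i, Module K (L i)]
    {P : Type w} [AddCommMonoid P] [Module K P] (f : ∀ i j, L i →ₗ[K] L j →ₗ[K] P)
    (i j : ℕ) (a : L i) (b : L j) :
    directSumBilin f (DirectSum.lof K ℕ L i a) (DirectSum.lof K ℕ L j b) = f i j a b := by
  simp [directSumBilin]

/-- A bilinear map which vanishes on `p` and on `q` descends to the quotients. -/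
def quotBilin {A B C : Type*} [AddCommGroup A] [Module K A] [AddCommGroup B] [Module K B]
    [AddCommGroup C] [Module K C] (p : Submodule K A) (q : Submodule K B)
    (f : A →ₗ[K] B →ₗ[K] C) (hp : ∀ a ∈ p, ∀ b, f a b = 0) (hq : ∀ a, ∀ b ∈ q, f a b = 0) :
    (A ⧸ p) →ₗ[K] (B ⧸ q) →ₗ[K] C :=
  p.liftQ
    (LinearMap.flip (q.liftQ (LinearMap.flip f) (by
      intro b hb
      refine LinearMap.mem_ker.2 (LinearMap.ext fun a => ?_)
      simpa using hq a b hb)))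
    (by
      intro a ha
      refine LinearMap.mem_ker.2 (LinearMap.ext fun b => ?_)
      obtain ⟨b, rfl⟩ := q.mkQ_surjective b
      simpa using hp a ha b)

theorem quotBilin_mk {A B C : Type*} [AddCommGroup A] [Module K A] [AddCommGroup B] [Module K B]
    [AddCommGroup C] [Module K C] (p : Submodule K A) (q : Submodule K B)
    (f : A →ₗ[K] B →ₗ[K] C) (hp : ∀ a ∈ p, ∀ b, f a b = 0) (hq : ∀ a, ∀ b ∈ q, f a b = 0)
    (a : A) (b : B) : quotBilin p q f hp hq (p.mkQ a) (q.mkQ b) = f a b := by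
  simp [quotBilin]

end Bilinear

/-! ### Nonassociative graded algebras which are tensor products above a given degree -/

/-- Data in degrees `≤ d` from which a nonassociative graded superalgebra is built: graded
components (degree `0` being the field), products of components of positive degree, and the
`ℤ/2`-grading of the components. Only degrees `≤ d` matter. -/
structure TruncData (K : Type u) [Field K] where
  d : ℕ
  comp : ℕ → ModuleCat.{w} K
  unitEquiv : comp 0 ≃ₗ[K] K
  mul : ∀ i j, comp (i + 1) →ₗ[K] comp (j + 1) →ₗ[K] comp (i + 1 + (j + 1))
  par : ∀ n, ZMod 2 → Submodule K (comp n)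

/-- The ways to write `n = i + j` with `i, j ≥ 1`. -/
abbrev Splitting (n : ℕ) : Type := {p : ℕ × ℕ // 0 < p.1 ∧ 0 < p.2 ∧ p.1 + p.2 = n}

theorem Splitting.fst_lt {n : ℕ} (p : Splitting n) : p.1.1 < n := by have := p.2; omega

theorem Splitting.snd_lt {n : ℕ} (p : Splitting n) : p.1.2 < n := by have := p.2; omega

namespace TruncData

variable {K : Type u} [Field K] (D : TruncData.{u, w} K)

/-- The component of degree `n`: it is the given one if `n ≤ d`, and
`⨁_{i + j = n, i, j ≥ 1} (component i) ⊗ (component j)` if `n > d`. -/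
def level (n : ℕ) : ModuleCat.{w} K :=
  if n ≤ D.d then D.comp n
  else ModuleCat.of K (⨁ p : Splitting n, (level p.1.1 : Type w) ⊗[K] (level p.1.2 : Type w))
termination_by n
decreasing_by all_goals first | exact Splitting.fst_lt _ | exact Splitting.snd_lt _

def lowEquiv {n : ℕ} (h : n ≤ D.d) : D.level n ≃ₗ[K] D.comp n :=
  (CategoryTheory.eqToIso (by rw [level, if_pos h])).toLinearEquiv

def highEquiv {n : ℕ} (h : ¬ n ≤ D.d) :
    D.level n ≃ₗ[K] ⨁ p : Splitting n, (D.level p.1.1 : Type w) ⊗[K] (D.level p.1.2 : Type w) :=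
  (CategoryTheory.eqToIso (Y := ModuleCat.of K
    (⨁ p : Splitting n, (D.level p.1.1 : Type w) ⊗[K] (D.level p.1.2 : Type w)))
    (by rw [level, if_neg h])).toLinearEquiv

/-- The identification of the component of degree `0` with `K`. -/
def zeroEquiv : D.level 0 ≃ₗ[K] K := (D.lowEquiv (Nat.zero_le _)).trans D.unitEquiv

/-- The `ℤ/2`-grading of the component of degree `n`: the given one if `n ≤ d`, and
`⨁_{i + j = n} ⨁_{α + β = γ} (component i)_α ⊗ (component j)_β` if `n > d`. -/
def levelPar (n : ℕ) (γ : ZMod 2) : Submodule K (D.level n) :=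
  if h : n ≤ D.d then (D.par n γ).comap (D.lowEquiv h).toLinearMap
  else (⨆ p : Splitting n, ⨆ α : ZMod 2, ⨆ β : ZMod 2, ⨆ _ : α + β = γ,
      (Submodule.map₂ (TensorProduct.mk K (D.level p.1.1) (D.level p.1.2))
        (levelPar p.1.1 α) (levelPar p.1.2 β)).map
          (DirectSum.lof K (Splitting n)
            (fun p => (D.level p.1.1 : Type w) ⊗[K] (D.level p.1.2 : Type w)) p)).comap
        (D.highEquiv h).toLinearMap
termination_by n
decreasing_by all_goals first | exact Splitting.fst_lt _ | exact Splitting.snd_lt _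

/-- The algebra built from `D`, as a vector space. -/
abbrev Alg : Type w := ⨁ n, (D.level n : Type w)

abbrev of (n : ℕ) : D.level n →ₗ[K] D.Alg :=
  DirectSum.lof K ℕ (fun n => (D.level n : Type w)) n

/-- The product of elements of degrees `i` and `j`: multiplication by a scalar if `i = 0` or
`j = 0`, the given product if `i, j ≥ 1` and `i + j ≤ d`, the tensor product if `i, j ≥ 1` and
`i + j > d`. -/
def mulPiece : ∀ i j : ℕ, D.level i →ₗ[K] D.level j →ₗ[K] D.Alg
  | 0, j => LinearMap.mk₂ K (fun a b => D.zeroEquiv a • D.of j b)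
      (by intros; simp [add_smul]) (by intros; simp [mul_smul])
      (by intros; simp) (by intros; rw [map_smul, smul_comm])
  | i + 1, 0 => LinearMap.mk₂ K (fun a b => D.zeroEquiv b • D.of (i + 1) a)
      (by intros; simp) (by intros; rw [map_smul, smul_comm])
      (by intros; simp [add_smul]) (by intros; simp [mul_smul])
  | i + 1, j + 1 =>
      if h : i + 1 + (j + 1) ≤ D.d then
        ((D.mul i j).compl₁₂ (D.lowEquiv (by omega)).toLinearMap
          (D.lowEquiv (by omega)).toLinearMap).compr₂
            ((D.of (i + 1 + (j + 1))).comp (D.lowEquiv h).symm.toLinearMap)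
      else
        (TensorProduct.mk K (D.level (i + 1)) (D.level (j + 1))).compr₂
          ((D.of (i + 1 + (j + 1))).comp
            ((D.highEquiv h).symm.toLinearMap.comp
              (DirectSum.lof K (Splitting (i + 1 + (j + 1)))
                (fun p => (D.level p.1.1 : Type w) ⊗[K] (D.level p.1.2 : Type w))
                ⟨(i + 1, j + 1), Nat.succ_pos i, Nat.succ_pos j, rfl⟩)))

/-- The multiplication. -/
def mulMap : D.Alg →ₗ[K] D.Alg →ₗ[K] D.Alg := directSumBilin D.mulPiece

/-- The unit element. -/
def one : D.Alg := D.of 0 (D.zeroEquiv.symm 1)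

/-- The homogeneous component of degree `n`. -/
def degree (n : ℕ) : Submodule K D.Alg := LinearMap.range (D.of n)

/-- The even part (`γ = 0`) and the odd part (`γ = 1`). -/
def parity (γ : ZMod 2) : Submodule K D.Alg := ⨆ n, (D.levelPar n γ).map (D.of n)

/-- The elements of degree `≤ n`. -/
def filtration (n : ℕ) : Submodule K D.Alg := ⨆ i : Fin (n + 1), D.degree i

theorem mulPiece_mem (i j : ℕ) (a : D.level i) (b : D.level j) :
    D.mulPiece i j a b ∈ D.degree (i + j) := by
  match i, j, a, b with
  | 0, j, a, b =>
    rw [Nat.zero_add]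
    exact Submodule.smul_mem _ _ ⟨b, rfl⟩
  | i + 1, 0, a, b => exact Submodule.smul_mem _ _ ⟨a, rfl⟩
  | i + 1, j + 1, a, b =>
    by_cases h : i + 1 + (j + 1) ≤ D.d
    · rw [mulPiece, dif_pos h]; exact ⟨_, rfl⟩
    · rw [mulPiece, dif_neg h]; exact ⟨_, rfl⟩

theorem degree_le_filtration {i n : ℕ} (h : i ≤ n) : D.degree i ≤ D.filtration n :=
  le_iSup (fun i : Fin (n + 1) => D.degree i) ⟨i, Nat.lt_succ_of_le h⟩

theorem filtration_mono {m n : ℕ} (h : m ≤ n) : D.filtration m ≤ D.filtration n :=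
  iSup_le fun i => D.degree_le_filtration ((Nat.le_of_lt_succ i.2).trans h)

theorem mul_mem_filtration (m n : ℕ) (a b : D.Alg) (ha : a ∈ D.filtration m)
    (hb : b ∈ D.filtration n) : D.mulMap a b ∈ D.filtration (m + n) := by
  have key : Submodule.map₂ D.mulMap (D.filtration m) (D.filtration n)
      ≤ D.filtration (m + n) := by
    unfold filtration
    rw [Submodule.map₂_iSup_left]
    refine iSup_le fun i => ?_
    rw [Submodule.map₂_iSup_right]
    refine iSup_le fun j => Submodule.map₂_le.2 ?_
    rintro _ ⟨x, rfl⟩ _ ⟨y, rfl⟩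
    have h : D.mulMap (D.of i x) (D.of j y) = D.mulPiece i j x y := directSumBilin_lof _ _ _ _ _
    rw [h]
    exact D.degree_le_filtration (by omega) (D.mulPiece_mem i j x y)
  exact key (Submodule.apply_mem_map₂ _ ha hb)

end TruncData

/-! ### The nonassociative tensor algebra -/

section Tensor

variable (K : Type u) (M : Type v) [Field K] [AddCommGroup M] [Module K M]

/-- Degree `0` is `K`, degree `1` is `M` (degrees `≥ 2` are not used). -/
def tensorComp : ℕ → ModuleCat.{max u v} K
  | 0 => ModuleCat.of K (ULift.{v} K)
  | _ + 1 => ModuleCat.of K (ULift.{u} M)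

variable {K M}

/-- `K` in degree `0`, which is even, and `M = M₀ ⊕ M₁` in degree `1`. -/
def tensorData (gr : ZMod 2 → Submodule K M) : TruncData.{u, max u v} K where
  d := 1
  comp := tensorComp K M
  unitEquiv := ULift.moduleEquiv
  mul _ _ := 0
  par
    | 0, γ => if γ = 0 then ⊤ else ⊥
    | _ + 1, γ => (gr γ).comap (ULift.moduleEquiv : ULift.{u} M ≃ₗ[K] M).toLinearMap

/-- The nonassociative tensor algebra `T̃(M)`, with `T̃⁰(M) = K`, `T̃¹(M) = M` and
`T̃ⁿ(M) = ⨁_{0 < i < n} T̃ⁱ(M) ⊗ T̃ⁿ⁻ⁱ(M)` for `n ≥ 2`. -/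
abbrev NATensor (gr : ZMod 2 → Submodule K M) : Type (max u v) := (tensorData gr).Alg

/-- The inclusion of `M` in `T̃(M)`. -/
def NATensor.ι (gr : ZMod 2 → Submodule K M) : M →ₗ[K] NATensor gr :=
  ((tensorData gr).of 1).comp
    (((tensorData gr).lowEquiv (n := 1) le_rfl).symm.toLinearMap.comp
      (ULift.moduleEquiv : ULift.{u} M ≃ₗ[K] M).symm.toLinearMap)

end Tensor

/-! ### The supersymmetric superalgebra and `V(M)` -/

section Symmetric

variable {K : Type u} {M : Type v} [Field K] [AddCommGroup M] [Module K M]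

/-- The relations `x ⊗ y = (-1)^{αβ} y ⊗ x` in the (associative) tensor algebra. -/
inductive SuperSymRel (gr : ZMod 2 → Submodule K M) : TensorAlgebra K M → TensorAlgebra K M → Prop
  | swap (α β : ZMod 2) (x y : M) (hx : x ∈ gr α) (hy : y ∈ gr β) :
      SuperSymRel gr (TensorAlgebra.ι K x * TensorAlgebra.ι K y)
        (sgn K (α * β) • (TensorAlgebra.ι K y * TensorAlgebra.ι K x))

/-- The supersymmetric superalgebra `S(M)`. -/
abbrev SuperSym (gr : ZMod 2 → Submodule K M) : Type (max u v) := RingQuot (SuperSymRel gr)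

def SuperSym.ι (gr : ZMod 2 → Submodule K M) : M →ₗ[K] SuperSym gr :=
  (RingQuot.mkAlgHom K (SuperSymRel gr)).toLinearMap.comp (TensorAlgebra.ι K)

/-- `Sⁿ(M)`, the image of `M ⊗ ⋯ ⊗ M` (`n` factors) in `S(M)`. -/
def SuperSym.degree (gr : ZMod 2 → Submodule K M) (n : ℕ) : Submodule K (SuperSym gr) :=
  LinearMap.range (SuperSym.ι gr) ^ n

/-- `Sⁿ(M)_γ`, spanned by the products `m₁ ⋯ mₙ` with `mᵢ ∈ M_{αᵢ}` and `α₁ + ⋯ + αₙ = γ`. -/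
def SuperSym.degreePar (gr : ZMod 2 → Submodule K M) (n : ℕ) (γ : ZMod 2) :
    Submodule K (SuperSym.degree gr n) :=
  (Submodule.span K {s | ∃ (m : Fin n → M) (α : Fin n → ZMod 2), (∀ i, m i ∈ gr (α i)) ∧
    ∑ i, α i = γ ∧ s = (List.ofFn fun i => SuperSym.ι gr (m i)).prod}).comap
      (SuperSym.degree gr n).subtype

/-- The product `Sⁱ(M) × Sʲ(M) → Sⁱ⁺ʲ(M)`. -/
def SuperSym.degreeMul (gr : ZMod 2 → Submodule K M) (i j : ℕ) :
    SuperSym.degree gr i →ₗ[K] SuperSym.degree gr j →ₗ[K] SuperSym.degree gr (i + j) :=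
  LinearMap.mk₂ K
    (fun a b => ⟨a.1 * b.1, by
      unfold SuperSym.degree; rw [pow_add]; exact Submodule.mul_mem_mul a.2 b.2⟩)
    (by intros; ext; simp [add_mul]) (by intros; ext; simp)
    (by intros; ext; simp [mul_add]) (by intros; ext; simp)

/-- `K` in degree `0` (identified with `S⁰(M)`) and `Sⁿ(M)` in degree `n ≥ 1`. -/
def symComp (gr : ZMod 2 → Submodule K M) : ℕ → ModuleCat.{max u v} K
  | 0 => ModuleCat.of K (ULift.{v} K)
  | n + 1 => ModuleCat.of K (SuperSym.degree gr (n + 1))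

/-- The part of degree `≤ 3` of the supersymmetric superalgebra. -/
def symData (gr : ZMod 2 → Submodule K M) : TruncData.{u, max u v} K where
  d := 3
  comp := symComp gr
  unitEquiv := ULift.moduleEquiv
  mul i j := SuperSym.degreeMul gr (i + 1) (j + 1)
  par
    | 0, γ => if γ = 0 then ⊤ else ⊥
    | n + 1, γ => SuperSym.degreePar gr (n + 1) γ

/-- The nonassociative superalgebra `V(M)`, with `Vⁿ(M) = Sⁿ(M)` for `n ≤ 3` and
`Vⁿ(M) = ⨁_{0 < i < n} Vⁱ(M) ⊗ Vⁿ⁻ⁱ(M)` for `n > 3`. -/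
abbrev V (gr : ZMod 2 → Submodule K M) : Type (max u v) := (symData gr).Alg

/-- The inclusion of `M = V¹(M)` in `V(M)`. -/
def V.ι (gr : ZMod 2 → Submodule K M) : M →ₗ[K] V gr :=
  ((symData gr).of 1).comp
    (((symData gr).lowEquiv (n := 1) (by decide : 1 ≤ 3)).symm.toLinearMap.comp
      ((SuperSym.ι gr).codRestrict (SuperSym.degree gr 1) (fun m => by
        unfold SuperSym.degree; rw [pow_one]; exact ⟨m, rfl⟩)))

end Symmetric

/-! ### Ideals and the universal enveloping superalgebra -/

section Ideal

variable {K : Type u} [Field K] {A : Type w} [AddCommGroup A] [Module K A]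

/-- The two-sided ideal generated by `S` for the multiplication `μ`. -/
def idealSpan (μ : A →ₗ[K] A →ₗ[K] A) (S : Set A) : Submodule K A :=
  sInf {J | S ⊆ J ∧ ∀ a, ∀ b ∈ J, μ a b ∈ J ∧ μ b a ∈ J}

theorem mul_mem_idealSpan (μ : A →ₗ[K] A →ₗ[K] A) (S : Set A) (a b : A) (hb : b ∈ idealSpan μ S) :
    μ a b ∈ idealSpan μ S ∧ μ b a ∈ idealSpan μ S := by
  simp only [idealSpan, Submodule.mem_sInf] at hb ⊢
  exact ⟨fun J hJ => (hJ.2 a b (hb J hJ)).1, fun J hJ => (hJ.2 a b (hb J hJ)).2⟩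

end Ideal

namespace AkivisSuperalgebra

variable {K : Type u} {M : Type v} [Field K] [AddCommGroup M] [Module K M]
  (X : AkivisSuperalgebra K M)

/-- The generators `x ⊗ y - (-1)^{αβ} y ⊗ x - [x, y]` and
`(x ⊗ y) ⊗ z - x ⊗ (y ⊗ z) - A(x, y, z)`, for homogeneous `x`, `y`, `z`. -/
def relations : Set (NATensor X.gr) :=
  let ι := NATensor.ι X.gr
  let μ := (tensorData X.gr).mulMap
  {t | ∃ α β x y, x ∈ X.gr α ∧ y ∈ X.gr β ∧
      t = μ (ι x) (ι y) - sgn K (α * β) • μ (ι y) (ι x) - ι (X.bracket x y)} ∪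
  {t | ∃ α β γ x y z, x ∈ X.gr α ∧ y ∈ X.gr β ∧ z ∈ X.gr γ ∧
      t = μ (μ (ι x) (ι y)) (ι z) - μ (ι x) (μ (ι y) (ι z)) - ι (X.A x y z)}

/-- The ideal `I` of `T̃(M)`. -/
def ideal : Submodule K (NATensor X.gr) := idealSpan (tensorData X.gr).mulMap X.relations

/-- The universal enveloping superalgebra `Ũ(M) = T̃(M) / I`. -/
abbrev Env : Type (max u v) := NATensor X.gr ⧸ X.ideal

namespace Env

/-- The multiplication of `Ũ(M)`. -/
def mulMap : X.Env →ₗ[K] X.Env →ₗ[K] X.Env :=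
  quotBilin X.ideal X.ideal ((tensorData X.gr).mulMap.compr₂ X.ideal.mkQ)
    (fun a ha b => by
      exact (Submodule.Quotient.mk_eq_zero _).2 (mul_mem_idealSpan _ _ b a ha).2)
    (fun a b hb => by
      exact (Submodule.Quotient.mk_eq_zero _).2 (mul_mem_idealSpan _ _ a b hb).1)

def one : X.Env := X.ideal.mkQ (tensorData X.gr).one

/-- The canonical map `ι : M → Ũ(M)`. -/
def ι : M →ₗ[K] X.Env := X.ideal.mkQ.comp (NATensor.ι X.gr)

/-- The image of `T̃ⁿ(M)` in `Ũ(M)`. -/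
def degree (n : ℕ) : Submodule K X.Env := ((tensorData X.gr).degree n).map X.ideal.mkQ

/-- The `ℤ/2`-grading of `Ũ(M)`, induced by that of `T̃(M)`. -/
def parity (γ : ZMod 2) : Submodule K X.Env := ((tensorData X.gr).parity γ).map X.ideal.mkQ

/-- The filtration `Ũₙ(M)`, the image of `⨁_{i ≤ n} T̃ⁱ(M)`. -/
def filtration (n : ℕ) : Submodule K X.Env := ((tensorData X.gr).filtration n).map X.ideal.mkQ

theorem filtration_mono {m n : ℕ} (h : m ≤ n) : filtration X m ≤ filtration X n :=
  Submodule.map_mono ((tensorData X.gr).filtration_mono h)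

theorem mul_mem_filtration (m n : ℕ) (a b : X.Env) (ha : a ∈ filtration X m)
    (hb : b ∈ filtration X n) : mulMap X a b ∈ filtration X (m + n) := by
  obtain ⟨a, ha, rfl⟩ := ha
  obtain ⟨b, hb, rfl⟩ := hb
  have h : mulMap X (X.ideal.mkQ a) (X.ideal.mkQ b)
      = X.ideal.mkQ ((tensorData X.gr).mulMap a b) := quotBilin_mk _ _ _ _ _ _ _
  rw [h]
  exact ⟨_, (tensorData X.gr).mul_mem_filtration m n a b ha hb, rfl⟩

theorem one_mem_filtration : one X ∈ filtration X 0 :=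
  ⟨_, (tensorData X.gr).degree_le_filtration le_rfl ⟨_, rfl⟩, rfl⟩

theorem ι_mem_filtration (m : M) : ι X m ∈ filtration X 1 :=
  ⟨_, (tensorData X.gr).degree_le_filtration le_rfl ⟨_, rfl⟩, rfl⟩

/-- `Ũₙ₋₁(M)`, with the convention `Ũ₋₁(M) = 0`. -/
def prev : ℕ → Submodule K X.Env
  | 0 => ⊥
  | n + 1 => filtration X n

theorem prev_le (n : ℕ) : prev X n ≤ filtration X n := by
  cases n with
  | zero => exact bot_le
  | succ n => exact filtration_mono X (Nat.le_succ n)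

theorem mul_mem_prev_left (m n : ℕ) (a b : X.Env) (ha : a ∈ prev X m)
    (hb : b ∈ filtration X n) : mulMap X a b ∈ prev X (m + n) := by
  cases m with
  | zero =>
    have h : a = 0 := ha
    rw [h, map_zero, LinearMap.zero_apply]
    exact Submodule.zero_mem _
  | succ m =>
    rw [Nat.succ_add]
    exact mul_mem_filtration X m n a b ha hb

theorem mul_mem_prev_right (m n : ℕ) (a b : X.Env) (ha : a ∈ filtration X m)
    (hb : b ∈ prev X n) : mulMap X a b ∈ prev X (m + n) := by
  cases n with
  | zero =>
    have h : b = 0 := hb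
    rw [h, map_zero]
    exact Submodule.zero_mem _
  | succ n => exact mul_mem_filtration X m n a b ha hb

end Env

/-! ### The associated graded superalgebra -/

/-- `Ũₙ(M) / Ũₙ₋₁(M)`. -/
abbrev GrPiece (n : ℕ) : Type (max u v) :=
  Env.filtration X n ⧸ (Env.prev X n).comap (Env.filtration X n).subtype

/-- The associated graded superalgebra `gr Ũ(M)`, as a vector space. -/
abbrev GrEnv : Type (max u v) := ⨁ n, X.GrPiece n

namespace GrEnv

/-- The class of an element of `Ũₙ(M)` in the component of degree `n` of `gr Ũ(M)`. -/
def cls (n : ℕ) : Env.filtration X n →ₗ[K] X.GrEnv :=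
  (DirectSum.lof K ℕ X.GrPiece n).comp (Submodule.mkQ _)

/-- `(a + Ũᵢ₋₁(M)) (b + Ũⱼ₋₁(M)) = ab + Ũᵢ₊ⱼ₋₁(M)` for `a ∈ Ũᵢ(M)`, `b ∈ Ũⱼ(M)`. -/
def mulPiece (i j : ℕ) : X.GrPiece i →ₗ[K] X.GrPiece j →ₗ[K] X.GrPiece (i + j) :=
  quotBilin _ _
    ((LinearMap.mk₂ K
      (fun (a : Env.filtration X i) (b : Env.filtration X j) =>
        (⟨Env.mulMap X a b, Env.mul_mem_filtration X i j a b a.2 b.2⟩ :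
          Env.filtration X (i + j)))
      (by intros; ext; simp) (by intros; ext; simp)
      (by intros; ext; simp) (by intros; ext; simp)).compr₂ (Submodule.mkQ _))
    (fun a ha b => by
      refine (Submodule.Quotient.mk_eq_zero _).2 ?_
      exact Env.mul_mem_prev_left X i j a b ha b.2)
    (fun a b hb => by
      refine (Submodule.Quotient.mk_eq_zero _).2 ?_
      exact Env.mul_mem_prev_right X i j a b a.2 hb)

/-- The multiplication of `gr Ũ(M)`. -/
def mulMap : X.GrEnv →ₗ[K] X.GrEnv →ₗ[K] X.GrEnv :=
  directSumBilin (L := X.GrPiece) fun i j => (mulPiece X i j).compr₂ (DirectSum.lof K ℕ X.GrPiece (i + j))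

/-- The unit element. -/
def one : X.GrEnv := cls X 0 ⟨Env.one X, Env.one_mem_filtration X⟩

/-- The map sending `m ∈ M` to the class of `ι m` in `Ũ₁(M) / Ũ₀(M)`. -/
def ι : M →ₗ[K] X.GrEnv :=
  (cls X 1).comp ((Env.ι X).codRestrict (Env.filtration X 1) (Env.ι_mem_filtration X))

/-- The homogeneous component of degree `n`. -/
def degree (n : ℕ) : Submodule K X.GrEnv := LinearMap.range (DirectSum.lof K ℕ X.GrPiece n)

/-- The `ℤ/2`-grading: the sum over `n` of the images of `Ũₙ(M) ∩ Ũ(M)_γ`. -/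
def parity (γ : ZMod 2) : Submodule K X.GrEnv :=
  ⨆ n, ((Env.parity X γ).comap (Env.filtration X n).subtype).map (cls X n)

end GrEnv

end AkivisSuperalgebra

end

end AkivisSuper

open AkivisSuper

namespace AkivisSuper

noncomputable section

/-! ### Products, parities and filtrations in an algebra built from truncated data. -/

namespace TruncData

variable {K : Type u} [Field K] (D : TruncData.{u, w} K)

/-! The product of `V(M)` is deformed by a bilinear map `c` which lowers degrees, so that `V(M)`
with the product `vw + c(v, w)` becomes `Ũ(M)`. The map `c` lives in the bidegrees (1,1), (2,1) and
(1,2) only. Put `c(x, y) = [x, y] / 2`, `c(xy, z) = p(x, y, z)` and `c(x, yz) = q(x, y, z)`. For `c`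
to be well defined on `S²(M)`, `p` has to be supersymmetric in its first two arguments and `q` in
its last two. The relation for the associator then reads `p - q = F`, where `F` is the explicit
combination `defect` of `A`, brackets and products. The super Akivis identity implies that the
super-antisymmetrization of `F` vanishes (`defect_alternating`), and when 6 is invertible a
computation in the group algebra of the symmetric group on three letters writes every such `F` as `p
- q` (`exists_supersymmetric_sub`).

The deformed algebra satisfies the relations (`IsCorrection.isRepresentation`), so it receives a
homomorphism from `Ũ(M)`. Conversely it maps to every algebra satisfying them
(`IsCorrection.exists_hom`). The values in degrees 1 and 2 are forced. A value in degree 3 is forced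
twice, through `(xy)z` and through `x(yz)`; the two agree, and each expression shows one of the two
symmetries needed to factor through `S³(M)`. Above degree 3, `V(M)` consists of tensor products and
the extension is free. The two homomorphisms are mutually inverse, since both composites fix `M`
(`IsCorrection.exists_equiv`).

This isomorphism respects filtrations and parities. As `c` lowers degrees, it disappears in the
associated graded algebra (`IsCorrection.exists_grEquiv`). For the trivial Akivis superalgebra, `c =
0` is a correction, and degrees themselves are preserved. -/

theorem mulMap_of_of (i j : ℕ) (a : D.level i) (b : D.level j) :
    D.mulMap (D.of i a) (D.of j b) = D.mulPiece i j a b :=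
  directSumBilin_lof _ _ _ _ _

/-- Linear maps out of the algebra are determined on the homogeneous elements. -/
theorem hom_ext {P : Type*} [AddCommMonoid P] [Module K P] {f g : D.Alg →ₗ[K] P}
    (h : ∀ n x, f (D.of n x) = g (D.of n x)) : f = g :=
  DirectSum.linearMap_ext K fun n => LinearMap.ext fun x => h n x

theorem hom_ext₂ {P : Type*} [AddCommMonoid P] [Module K P] {f g : D.Alg →ₗ[K] D.Alg →ₗ[K] P}
    (h : ∀ i j a b, f (D.of i a) (D.of j b) = g (D.of i a) (D.of j b)) : f = g :=
  D.hom_ext fun i a => D.hom_ext fun j b => h i j a b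

theorem of_zero_mul (a : D.level 0) (v : D.Alg) :
    D.mulMap (D.of 0 a) v = D.zeroEquiv a • v := by
  have : D.mulMap (D.of 0 a) = D.zeroEquiv a • LinearMap.id :=
    D.hom_ext fun j b => by rw [mulMap_of_of]; cases j <;> rfl
  rw [this]; rfl

theorem mul_of_zero (a : D.level 0) (v : D.Alg) :
    D.mulMap v (D.of 0 a) = D.zeroEquiv a • v := by
  have : D.mulMap.flip (D.of 0 a) = D.zeroEquiv a • LinearMap.id :=
    D.hom_ext fun j b => by
      rw [LinearMap.flip_apply, mulMap_of_of]
      cases j with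
      | zero =>
        -- `mulPiece` tests its left degree first, so in bidegree (0,0) it is the left factor that
        -- acts as the scalar.
        change D.zeroEquiv b • D.of 0 a = D.zeroEquiv a • D.of 0 b
        rw [← map_smul, ← map_smul]
        congr 1
        apply D.zeroEquiv.injective
        simp [mul_comm]
      | succ j => rfl
  exact LinearMap.congr_fun this v

theorem one_mul (v : D.Alg) : D.mulMap D.one v = v := by
  rw [one, of_zero_mul, LinearEquiv.apply_symm_apply, one_smul]

theorem mul_one (v : D.Alg) : D.mulMap v D.one = v := by
  rw [one, mul_of_zero, LinearEquiv.apply_symm_apply, one_smul]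

theorem of_zero_eq (a : D.level 0) : D.of 0 a = D.zeroEquiv a • D.one := by
  rw [one, ← map_smul, ← map_smul, smul_eq_mul, _root_.mul_one, LinearEquiv.symm_apply_apply]

theorem of_mul_of_low {i j : ℕ} (h : i + 1 + (j + 1) ≤ D.d) (a : D.comp (i + 1))
    (b : D.comp (j + 1)) :
    D.mulMap (D.of (i + 1) ((D.lowEquiv (by omega)).symm a))
      (D.of (j + 1) ((D.lowEquiv (by omega)).symm b))
      = D.of (i + 1 + (j + 1)) ((D.lowEquiv h).symm (D.mul i j a b)) := by
  rw [mulMap_of_of, mulPiece, dif_pos h]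
  simp

theorem of_mul_of_high {i j : ℕ} (h : ¬ i + 1 + (j + 1) ≤ D.d) (a : D.level (i + 1))
    (b : D.level (j + 1)) :
    D.mulMap (D.of (i + 1) a) (D.of (j + 1) b)
      = D.of (i + 1 + (j + 1)) ((D.highEquiv h).symm
          (DirectSum.lof K (Splitting (i + 1 + (j + 1)))
            (fun p => (D.level p.1.1 : Type w) ⊗[K] (D.level p.1.2 : Type w))
            ⟨(i + 1, j + 1), Nat.succ_pos i, Nat.succ_pos j, rfl⟩ (a ⊗ₜ[K] b))) := by
  rw [mulMap_of_of, mulPiece, dif_neg h]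
  rfl

/-- Above the degree `d` the homogeneous components are spanned by products. -/
theorem degree_le_of_high {n : ℕ} (h : ¬ n ≤ D.d) (Q : Submodule K D.Alg)
    (hQ : ∀ i j a b, i + 1 + (j + 1) = n → D.mulMap (D.of (i + 1) a) (D.of (j + 1) b) ∈ Q) :
    D.degree n ≤ Q := by
  rintro _ ⟨x, rfl⟩
  obtain ⟨y, rfl⟩ := (D.highEquiv h).symm.surjective x
  induction y using DirectSum.induction_on with
  | zero => simp
  | add x y hx hy => simpa only [map_add] using add_mem hx hy
  | of p t =>
    obtain ⟨⟨i, j⟩, hi, hj, hij⟩ := p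
    obtain ⟨i, rfl⟩ := Nat.exists_eq_succ_of_ne_zero (Nat.ne_of_gt hi)
    obtain ⟨j, rfl⟩ := Nat.exists_eq_succ_of_ne_zero (Nat.ne_of_gt hj)
    subst hij
    induction t using TensorProduct.induction_on with
    | zero => simp
    | add x y hx hy => simpa only [map_add] using add_mem hx hy
    | tmul a b =>
      have := hQ i j a b rfl
      rw [of_mul_of_high D h] at this
      exact this

theorem of_levelPar_low {n : ℕ} (h : n ≤ D.d) (γ : ZMod 2) :
    D.levelPar n γ = (D.par n γ).comap (D.lowEquiv h).toLinearMap := by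
  rw [levelPar, dif_pos h]

/-- Above the degree `d` the homogeneous components of given parity are spanned by products. -/
theorem levelPar_le_of_high {n : ℕ} (h : ¬ n ≤ D.d) (γ : ZMod 2) (Q : Submodule K D.Alg)
    (hQ : ∀ i j α β a b, i + 1 + (j + 1) = n → α + β = γ → a ∈ D.levelPar (i + 1) α →
      b ∈ D.levelPar (j + 1) β → D.mulMap (D.of (i + 1) a) (D.of (j + 1) b) ∈ Q) :
    (D.levelPar n γ).map (D.of n) ≤ Q := by
  have : D.levelPar n γ ≤ Q.comap (D.of n) := by
    rw [levelPar, dif_neg h]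
    -- Transport along `highEquiv` turns the goal into an upper bound for a supremum.
    have key : ∀ S : Submodule K (⨁ p : Splitting n,
        (D.level p.1.1 : Type w) ⊗[K] (D.level p.1.2 : Type w)),
        S ≤ (Q.comap (D.of n)).comap (D.highEquiv h).symm.toLinearMap →
        S.comap (D.highEquiv h).toLinearMap ≤ Q.comap (D.of n) := by
      intro S hS x hx
      have := hS hx
      simpa using this
    apply key
    refine iSup_le fun p => iSup_le fun α => iSup_le fun β => iSup_le fun hαβ => ?_
    obtain ⟨⟨i, j⟩, hi, hj, hij⟩ := p
    obtain ⟨i, rfl⟩ := Nat.exists_eq_succ_of_ne_zero (Nat.ne_of_gt hi)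
    obtain ⟨j, rfl⟩ := Nat.exists_eq_succ_of_ne_zero (Nat.ne_of_gt hj)
    subst hij
    rw [Submodule.map_le_iff_le_comap]
    refine Submodule.map₂_le.2 fun a ha b hb => ?_
    have := hQ i j α β a b rfl hαβ ha hb
    rw [of_mul_of_high D h] at this
    exact this
  exact Submodule.map_le_iff_le_comap.2 this

theorem of_mem_parity {n : ℕ} {γ : ZMod 2} {a : D.level n} (ha : a ∈ D.levelPar n γ) :
    D.of n a ∈ D.parity γ :=
  Submodule.mem_iSup_of_mem n ⟨a, ha, rfl⟩

theorem mul_mem_levelPar_high {i j : ℕ} (h : ¬ i + 1 + (j + 1) ≤ D.d) {α β : ZMod 2}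
    {a : D.level (i + 1)} {b : D.level (j + 1)} (ha : a ∈ D.levelPar (i + 1) α)
    (hb : b ∈ D.levelPar (j + 1) β) :
    D.mulMap (D.of (i + 1) a) (D.of (j + 1) b)
      ∈ (D.levelPar (i + 1 + (j + 1)) (α + β)).map (D.of (i + 1 + (j + 1))) := by
  rw [of_mul_of_high D h]
  refine ⟨_, ?_, rfl⟩
  rw [levelPar, dif_neg h]
  simp only [Submodule.comap_coe, Set.mem_preimage, LinearEquiv.coe_coe, SetLike.mem_coe,
    LinearEquiv.apply_symm_apply]
  refine Submodule.mem_iSup_of_mem ⟨(i + 1, j + 1), Nat.succ_pos i, Nat.succ_pos j, rfl⟩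
    (Submodule.mem_iSup_of_mem α (Submodule.mem_iSup_of_mem β (Submodule.mem_iSup_of_mem rfl ?_)))
  exact ⟨_, Submodule.apply_mem_map₂ _ ha hb, rfl⟩

/-- The given parities are compatible with the given unit and the given products. -/
structure IsSuper : Prop where
  par_zero : ∀ γ, D.par 0 γ = if γ = 0 then ⊤ else ⊥
  mul_mem : ∀ i j α β a b, i + 1 + (j + 1) ≤ D.d → a ∈ D.par (i + 1) α → b ∈ D.par (j + 1) β →
    D.mul i j a b ∈ D.par (i + 1 + (j + 1)) (α + β)

variable {D}

theorem IsSuper.one_mem (hD : D.IsSuper) : D.one ∈ D.parity 0 := by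
  refine D.of_mem_parity ?_
  rw [of_levelPar_low D (Nat.zero_le _), hD.par_zero]
  simp

theorem IsSuper.levelPar_zero_ne (hD : D.IsSuper) {γ : ZMod 2} (hγ : γ ≠ 0) {a : D.level 0}
    (ha : a ∈ D.levelPar 0 γ) : a = 0 := by
  rw [of_levelPar_low D (Nat.zero_le _), hD.par_zero, if_neg hγ] at ha
  simpa using ha

/-- Both parities are suprema over degrees, so homogeneous factors suffice. Degree 0 is purely even;
low degrees use `mul_mem`, and above `d` the parity is defined through products. -/
theorem IsSuper.mul_mem_parity (hD : D.IsSuper) {α β : ZMod 2} {a b : D.Alg}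
    (ha : a ∈ D.parity α) (hb : b ∈ D.parity β) : D.mulMap a b ∈ D.parity (α + β) := by
  have key : Submodule.map₂ D.mulMap (D.parity α) (D.parity β) ≤ D.parity (α + β) := by
    unfold parity
    rw [Submodule.map₂_iSup_left]
    refine iSup_le fun i => ?_
    rw [Submodule.map₂_iSup_right]
    refine iSup_le fun j => Submodule.map₂_le.2 ?_
    rintro _ ⟨x, hx, rfl⟩ _ ⟨y, hy, rfl⟩
    change _ ∈ D.parity (α + β)
    match i, j, x, y, hx, hy with
    | 0, j, x, y, hx, hy =>
      rw [of_zero_mul]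
      by_cases hα : α = 0
      · subst hα
        rw [zero_add]
        exact Submodule.smul_mem _ _ (D.of_mem_parity hy)
      · rw [hD.levelPar_zero_ne hα hx]; simp
    | i + 1, 0, x, y, hx, hy =>
      rw [mul_of_zero]
      by_cases hβ : β = 0
      · subst hβ
        rw [add_zero]
        exact Submodule.smul_mem _ _ (D.of_mem_parity hx)
      · rw [hD.levelPar_zero_ne hβ hy]; simp
    | i + 1, j + 1, x, y, hx, hy =>
      by_cases h : i + 1 + (j + 1) ≤ D.d
      · obtain ⟨x, rfl⟩ := (D.lowEquiv (n := i + 1) (by omega)).symm.surjective x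
        obtain ⟨y, rfl⟩ := (D.lowEquiv (n := j + 1) (by omega)).symm.surjective y
        rw [of_mul_of_low D h]
        refine D.of_mem_parity ?_
        rw [SetLike.mem_coe, of_levelPar_low D (by omega)] at hx hy
        rw [of_levelPar_low D h]
        simp only [Submodule.mem_comap, LinearEquiv.coe_coe,
          LinearEquiv.apply_symm_apply] at hx hy ⊢
        exact hD.mul_mem i j α β x y h (by simpa using hx) (by simpa using hy)
      · exact Submodule.mem_iSup_of_mem _ (mul_mem_levelPar_high D h hx hy)
  exact key (Submodule.apply_mem_map₂ _ ha hb)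

variable (D)

/-- The components of an element of given parity have this parity. -/
theorem component_mem_levelPar {γ : ZMod 2} {a : D.Alg} (ha : a ∈ D.parity γ) (n : ℕ) :
    DirectSum.component K ℕ (fun n => (D.level n : Type w)) n a ∈ D.levelPar n γ := by
  have : D.parity γ ≤ (D.levelPar n γ).comap
      (DirectSum.component K ℕ (fun n => (D.level n : Type w)) n) := by
    refine iSup_le fun m => Submodule.map_le_iff_le_comap.2 fun x hx => ?_
    by_cases h : m = n
    · subst h
      simpa [DirectSum.component.lof_self] using hx
    · simp only [Submodule.mem_comap]
      rw [DirectSum.component.of, dif_neg h]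
      exact zero_mem _
  exact this ha

theorem component_of_mem_filtration {n m : ℕ} (hm : n < m) {a : D.Alg}
    (ha : a ∈ D.filtration n) :
    DirectSum.component K ℕ (fun n => (D.level n : Type w)) m a = 0 := by
  have : D.filtration n ≤ LinearMap.ker
      (DirectSum.component K ℕ (fun n => (D.level n : Type w)) m) := by
    refine iSup_le fun i => ?_
    rintro _ ⟨x, rfl⟩
    rw [LinearMap.mem_ker, DirectSum.component.of, dif_neg (by omega)]
  exact this ha

/-- Splitting off the top component identifies the successive quotients of the filtration with the
graded pieces. -/
theorem exists_of_add_of_mem_filtration {n : ℕ} {a : D.Alg} (ha : a ∈ D.filtration (n + 1)) :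
    ∃ b ∈ D.filtration n, a = D.of (n + 1)
      (DirectSum.component K ℕ (fun n => (D.level n : Type w)) (n + 1) a) + b := by
  have : D.filtration (n + 1) ≤ D.degree (n + 1) ⊔ D.filtration n := by
    refine iSup_le fun i => ?_
    rcases Nat.lt_or_ge i (n + 1) with h | h
    · exact le_sup_of_le_right (D.degree_le_filtration (by omega))
    · have : (i : ℕ) = n + 1 := by omega
      rw [this]
      exact le_sup_left
  obtain ⟨_, ⟨x, rfl⟩, b, hb, rfl⟩ := Submodule.mem_sup.1 (this ha)
  refine ⟨b, hb, ?_⟩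
  rw [map_add, D.component_of_mem_filtration (Nat.lt_succ_self n) hb, add_zero,
    DirectSum.component.lof_self]

/-! ### Maps out of the algebra -/

section Lift

variable {P : Type*} [AddCommGroup P] [Module K P] (μ : P →ₗ[K] P →ₗ[K] P)
  (f : ∀ n, D.comp n →ₗ[K] P)

/-- The linear map which is `f` in degrees `≤ d` and which is multiplicative above. -/
def levelLift (n : ℕ) : D.level n →ₗ[K] P :=
  if h : n ≤ D.d then (f n).comp (D.lowEquiv h).toLinearMap
  else (DirectSum.toModule K (Splitting n) P fun p =>
    TensorProduct.lift (μ.compl₁₂ (levelLift p.1.1) (levelLift p.1.2))).comp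
      (D.highEquiv h).toLinearMap
termination_by n
decreasing_by all_goals first | exact Splitting.fst_lt _ | exact Splitting.snd_lt _

/-- The linear map which is `f` in degrees `≤ d` and which is multiplicative above. -/
def lift : D.Alg →ₗ[K] P := DirectSum.toModule K ℕ P (D.levelLift μ f)

theorem lift_of (n : ℕ) (x : D.level n) : D.lift μ f (D.of n x) = D.levelLift μ f n x :=
  DirectSum.toModule_lof _ _ _

theorem lift_of_low {n : ℕ} (h : n ≤ D.d) (x : D.level n) :
    D.lift μ f (D.of n x) = f n (D.lowEquiv h x) := by
  rw [lift_of, levelLift, dif_pos h]; rfl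

theorem lift_mul_high {i j : ℕ} (h : ¬ i + 1 + (j + 1) ≤ D.d) (a : D.level (i + 1))
    (b : D.level (j + 1)) : D.lift μ f (D.mulMap (D.of (i + 1) a) (D.of (j + 1) b))
      = μ (D.lift μ f (D.of (i + 1) a)) (D.lift μ f (D.of (j + 1) b)) := by
  rw [of_mul_of_high D h, lift_of, levelLift, dif_neg h, lift_of, lift_of]
  simp

theorem lift_one : D.lift μ f D.one = f 0 (D.unitEquiv.symm 1) := by
  rw [one, lift_of_low D μ f (Nat.zero_le _)]
  simp [zeroEquiv]

theorem lift_of_zero (x : D.level 0) :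
    D.lift μ f (D.of 0 x) = D.zeroEquiv x • f 0 (D.unitEquiv.symm 1) := by
  rw [of_zero_eq, map_smul, lift_one]

/-- The family `Q` need only be multiplicative, so that both filtrations and gradings of the target
are covered. Above `d`, products of lower components span. -/
theorem lift_mem_degree (Q : ℕ → Submodule K P) (hμ : ∀ i j a b, a ∈ Q i → b ∈ Q j →
    μ a b ∈ Q (i + j)) (hf : ∀ n ≤ D.d, ∀ x, f n x ∈ Q n) (n : ℕ) (x : D.level n) :
    D.lift μ f (D.of n x) ∈ Q n := by
  induction n using Nat.strong_induction_on with
  | _ n ih =>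
    by_cases h : n ≤ D.d
    · rw [lift_of_low D μ f h]; exact hf n h _
    · have := D.degree_le_of_high h ((Q n).comap (D.lift μ f)) fun i j a b hij => by
        subst hij
        rw [Submodule.mem_comap, lift_mul_high D μ f h]
        exact hμ _ _ _ _ (ih _ (by omega) a) (ih _ (by omega) b)
      exact this ⟨x, rfl⟩

theorem lift_mem_parity (Q : ZMod 2 → Submodule K P) (hμ : ∀ α β a b, a ∈ Q α → b ∈ Q β →
    μ a b ∈ Q (α + β)) (hf : ∀ n ≤ D.d, ∀ γ, ∀ x ∈ D.par n γ, f n x ∈ Q γ) (γ : ZMod 2) :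
    D.parity γ ≤ (Q γ).comap (D.lift μ f) := by
  refine iSup_le fun n => ?_
  -- `γ` must vary: a product of parity `γ` has factors of other parities.
  induction n using Nat.strong_induction_on generalizing γ with
  | _ n ih =>
    by_cases h : n ≤ D.d
    · rintro _ ⟨x, hx, rfl⟩
      rw [of_levelPar_low D h] at hx
      rw [Submodule.mem_comap, lift_of_low D μ f h]
      exact hf n h γ _ hx
    · refine D.levelPar_le_of_high h γ _ fun i j α β a b hij hαβ ha hb => ?_
      subst hij hαβ
      rw [Submodule.mem_comap, lift_mul_high D μ f h]
      exact hμ _ _ _ _ (ih _ (by omega) α ⟨a, ha, rfl⟩) (ih _ (by omega) β ⟨b, hb, rfl⟩)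

end Lift

end TruncData

theorem sgn_zero (K : Type u) [Ring K] : sgn K 0 = 1 := by simp [sgn]

theorem sgn_one (K : Type u) [Ring K] : sgn K 1 = -1 := by
  simp [sgn, ZMod.val_one]

/-! ### Linear maps out of the low degree components of `S(M)`. -/

section

variable {K : Type u} {M : Type v} [Field K] [AddCommGroup M] [Module K M]
  {gr : ZMod 2 → Submodule K M}

namespace SuperSym

theorem ι_mul_ι {α β : ZMod 2} {x y : M} (hx : x ∈ gr α) (hy : y ∈ gr β) :
    ι gr x * ι gr y = sgn K (α * β) • (ι gr y * ι gr x) := by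
  have h : SuperSymRel gr _ _ := SuperSymRel.swap α β x y hx hy
  have := RingQuot.mkAlgHom_rel K h
  simpa [ι] using this

/-- Operators which supercommute define a representation of the supersymmetric superalgebra. -/
theorem exists_algHom {N : Type*} [AddCommGroup N] [Module K N] (L : M →ₗ[K] Module.End K N)
    (hL : ∀ α β x y, x ∈ gr α → y ∈ gr β → L x * L y = sgn K (α * β) • (L y * L x)) :
    ∃ Φ : SuperSym gr →ₐ[K] Module.End K N, ∀ m, Φ (ι gr m) = L m := by
  refine ⟨RingQuot.liftAlgHom K ⟨TensorAlgebra.lift K L, ?_⟩, fun m => ?_⟩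
  · rintro _ _ ⟨α, β, x, y, hx, hy⟩
    simpa using hL α β x y hx hy
  · simp [ι]

/-- The element `m` acts on `K × M` by `(a, n) ↦ (0, a m)`. Products of two such operators vanish,
hence supercommute; evaluation at `(1, 0)` recovers `m`. -/
theorem exists_lift_one (gr : ZMod 2 → Submodule K M) :
    ∃ g : SuperSym gr →ₗ[K] M, ∀ x, g (ι gr x) = x := by
  let L : M →ₗ[K] Module.End K (K × M) := LinearMap.mk₂ K (fun m n => (0, n.1 • m))
    (by intros; ext <;> simp) (by intros; ext <;> simp [smul_smul, mul_comm])
    (by intros; ext <;> simp [add_smul]) (by intros; ext <;> simp [mul_smul])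
  obtain ⟨Φ, hΦ⟩ := exists_algHom (gr := gr) L (by
    intros
    refine LinearMap.ext fun n => ?_
    simp [L])
  refine ⟨(LinearMap.snd K K M).comp (Φ.toLinearMap.flip (1, 0)), fun x => ?_⟩
  simp [hΦ, L]

/-- Now `m` acts on `K × M × P` by `(a, n, p) ↦ (0, a m, f m n)`. Applying `y` and then `x` to `(1,
0, 0)` gives `f x y`, and the symmetry of `f` is exactly supercommutation of the operators. -/
theorem exists_lift_two {P : Type*} [AddCommGroup P] [Module K P] (f : M →ₗ[K] M →ₗ[K] P)
    (hf : ∀ α β x y, x ∈ gr α → y ∈ gr β → f x y = sgn K (α * β) • f y x) :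
    ∃ g : SuperSym gr →ₗ[K] P, ∀ x y, g (ι gr x * ι gr y) = f x y := by
  let L : M →ₗ[K] Module.End K (K × M × P) :=
    LinearMap.mk₂ K (fun m n => (0, n.1 • m, f m n.2.1))
      (by intros; ext <;> simp) (by intros; ext <;> simp [smul_smul, mul_comm])
      (by intros; ext <;> simp [add_smul]) (by intros; ext <;> simp [mul_smul])
  obtain ⟨Φ, hΦ⟩ := exists_algHom (gr := gr) L (by
    intro α β x y hx hy
    refine LinearMap.ext fun n => ?_
    simp [L, hf α β x y hx hy, smul_smul, mul_comm])
  refine ⟨(LinearMap.snd K M P).comp ((LinearMap.snd K K (M × P)).comp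
    (Φ.toLinearMap.flip (1, 0, 0))), fun x y => ?_⟩
  simp [hΦ, L]

/-- Symmetry in the last two arguments lets `f x y z` depend on `y z` in `S(M)` through `h`. Then
`S(M)` acts on `K × M × S(M) × P`, each factor feeding the next; supercommutation on the last factor
is symmetry in the first two arguments. -/
theorem exists_lift_three {P : Type*} [AddCommGroup P] [Module K P]
    (f : M →ₗ[K] M →ₗ[K] M →ₗ[K] P)
    (hf : ∀ α β x y z, x ∈ gr α → y ∈ gr β → f x y z = sgn K (α * β) • f y x z)
    (hf' : ∀ β γ x y z, y ∈ gr β → z ∈ gr γ → f x y z = sgn K (β * γ) • f x z y) :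
    ∃ g : SuperSym gr →ₗ[K] P, ∀ x y z, g (ι gr x * ι gr y * ι gr z) = f x y z := by
  -- Moving `x` to the end makes `f'` a bilinear map in `y, z` with values in `M →ₗ[K] P`.
  let f' : M →ₗ[K] M →ₗ[K] M →ₗ[K] P :=
    LinearMap.lflip.toLinearMap.comp f.flip
  have hf'_apply : ∀ x y z, f' y z x = f x y z := fun _ _ _ => rfl
  obtain ⟨h, hh⟩ := exists_lift_two (gr := gr) f' (by
    intro β γ y z hy hz
    refine LinearMap.ext fun x => ?_
    simpa [hf'_apply] using hf' β γ x y z hy hz)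
  let L : M →ₗ[K] Module.End K (K × M × SuperSym gr × P) :=
    LinearMap.mk₂ K (fun m n => (0, n.1 • m, ι gr m * ι gr n.2.1, h n.2.2.1 m))
      (by intros; ext <;> simp [add_mul]) (by intros; ext <;> simp [smul_smul, mul_comm])
      (by intros; ext <;> simp [add_smul, mul_add]) (by intros; ext <;> simp [mul_smul])
  obtain ⟨Φ, hΦ⟩ := exists_algHom (gr := gr) L (by
    intro α β x y hx hy
    refine LinearMap.ext fun n => ?_
    simp [L, hh, hf'_apply, hf α β x y _ hx hy, ι_mul_ι hx hy, smul_smul, mul_comm])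
  refine ⟨(LinearMap.snd K _ P).comp ((LinearMap.snd K M _).comp ((LinearMap.snd K K _).comp
    (Φ.toLinearMap.flip (1, 0, 0, 0)))), fun x y z => ?_⟩
  simp [hΦ, L, hh, hf'_apply]

theorem degree_one_le {Q : Submodule K (SuperSym gr)} (hQ : ∀ x, ι gr x ∈ Q) :
    degree gr 1 ≤ Q := by
  rw [degree, pow_one]
  rintro _ ⟨x, rfl⟩
  exact hQ x

theorem degree_two_le {Q : Submodule K (SuperSym gr)} (hQ : ∀ x y, ι gr x * ι gr y ∈ Q) :
    degree gr 2 ≤ Q := by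
  rw [degree, pow_two, Submodule.mul_le]
  rintro _ ⟨x, rfl⟩ _ ⟨y, rfl⟩
  exact hQ x y

theorem degree_three_le {Q : Submodule K (SuperSym gr)}
    (hQ : ∀ x y z, ι gr x * ι gr y * ι gr z ∈ Q) : degree gr 3 ≤ Q := by
  rw [degree, pow_succ, Submodule.mul_le]
  rintro a ha _ ⟨z, rfl⟩
  exact degree_two_le (Q := Q.comap (LinearMap.mulRight K (ι gr z))) (fun x y => hQ x y z) ha

theorem ι_mem (x : M) : ι gr x ∈ degree gr 1 := by
  rw [degree, pow_one]; exact ⟨x, rfl⟩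

theorem mul_mem_degree {i j : ℕ} {a b : SuperSym gr} (ha : a ∈ degree gr i)
    (hb : b ∈ degree gr j) : a * b ∈ degree gr (i + j) := by
  unfold degree; rw [pow_add]; exact Submodule.mul_mem_mul ha hb

/-- The product of two spans is spanned by products of generators, and these are concatenated words.
-/
theorem degreeMul_mem_degreePar {i j : ℕ} {α β : ZMod 2} {a : degree gr i} {b : degree gr j}
    (ha : a ∈ degreePar gr i α) (hb : b ∈ degreePar gr j β) :
    degreeMul gr i j a b ∈ degreePar gr (i + j) (α + β) := by
  have := Submodule.mul_mem_mul (show (a : SuperSym gr) ∈ Submodule.span K _ from ha)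
    (show (b : SuperSym gr) ∈ Submodule.span K _ from hb)
  rw [Submodule.span_mul_span] at this
  refine Submodule.span_mono ?_ this
  rintro _ ⟨_, ⟨m, μ, hm, rfl, rfl⟩, _, ⟨m', μ', hm', rfl, rfl⟩, rfl⟩
  refine ⟨Fin.append m m', Fin.append μ μ', fun k => ?_, ?_, ?_⟩
  · refine Fin.addCases (fun k => ?_) (fun k => ?_) k
    · simpa using hm k
    · simpa using hm' k
  · simp [Fin.sum_univ_add]
  · dsimp only
    rw [← List.prod_append, ← List.ofFn_fin_append]
    congr 2
    funext k
    refine Fin.addCases (fun k => ?_) (fun k => ?_) k <;> simp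

theorem ι_mem_degreePar {α : ZMod 2} {x : M} (hx : x ∈ gr α) :
    (⟨ι gr x, ι_mem x⟩ : degree gr 1) ∈ degreePar gr 1 α :=
  Submodule.subset_span ⟨fun _ => x, fun _ => α, fun _ => hx, by simp, by simp⟩

theorem degreePar_one_le {γ : ZMod 2} {Q : Submodule K (SuperSym gr)}
    (hQ : ∀ x ∈ gr γ, ι gr x ∈ Q) :
    degreePar gr 1 γ ≤ Q.comap (degree gr 1).subtype := by
  refine Submodule.comap_mono (Submodule.span_le.2 ?_)
  rintro _ ⟨m, μ, hm, rfl, rfl⟩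
  simpa using hQ (m 0) (by simpa using hm 0)

theorem degreePar_two_le {γ : ZMod 2} {Q : Submodule K (SuperSym gr)}
    (hQ : ∀ α β x y, x ∈ gr α → y ∈ gr β → α + β = γ → ι gr x * ι gr y ∈ Q) :
    degreePar gr 2 γ ≤ Q.comap (degree gr 2).subtype := by
  refine Submodule.comap_mono (Submodule.span_le.2 ?_)
  rintro _ ⟨m, μ, hm, rfl, rfl⟩
  simpa using hQ _ _ _ _ (hm 0) (hm 1) (by simp [Fin.sum_univ_succ])

theorem degreePar_three_le {γ : ZMod 2} {Q : Submodule K (SuperSym gr)}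
    (hQ : ∀ α β δ x y z, x ∈ gr α → y ∈ gr β → z ∈ gr δ → α + β + δ = γ →
      ι gr x * ι gr y * ι gr z ∈ Q) :
    degreePar gr 3 γ ≤ Q.comap (degree gr 3).subtype := by
  refine Submodule.comap_mono (Submodule.span_le.2 ?_)
  rintro _ ⟨m, μ, hm, rfl, rfl⟩
  simpa [mul_assoc] using
    hQ _ _ _ _ _ _ (hm 0) (hm 1) (hm 2) (by simp [Fin.sum_univ_succ, add_assoc])

end SuperSym

theorem symData_isSuper : (symData gr).IsSuper where
  par_zero _ := rfl
  mul_mem i j α β a b _ ha hb :=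
    SuperSym.degreeMul_mem_degreePar (gr := gr) (i := i + 1) (j := j + 1) (α := α) (β := β)
      (a := a) (b := b) ha hb

end

theorem zmod_two_eq_zero_or_one (α : ZMod 2) : α = 0 ∨ α = 1 := by revert α; decide

/-! ### Supersymmetrization of multilinear maps -/

section SuperFlip

variable {K : Type u} {M : Type v} [Field K] [AddCommGroup M] [Module K M]
  {gr : ZMod 2 → Submodule K M}

theorem hom_ext_of_isInternal (hgr : DirectSum.IsInternal gr) {P : Type*} [AddCommMonoid P]
    [Module K P] {f g : M →ₗ[K] P} (h : ∀ α, ∀ x ∈ gr α, f x = g x) : f = g := by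
  refine LinearMap.ext_on_range (v := fun x : Σ α, gr α => (x.2 : M)) ?_ fun x => h _ _ x.2.2
  rw [eq_top_iff, ← hgr.submodule_iSup_eq_top]
  exact iSup_le fun α x hx => Submodule.subset_span ⟨⟨α, x, hx⟩, rfl⟩

/-- The odd projection makes the sign `(-1)^{αβ}` a linear operation defined on all of `M`, as
`superFlip` requires. -/
theorem exists_oddProj (hgr : DirectSum.IsInternal gr) :
    ∃ π : M →ₗ[K] M, (∀ x ∈ gr 0, π x = 0) ∧ ∀ x ∈ gr 1, π x = x := by
  let e := LinearEquiv.ofBijective (DirectSum.coeLinearMap gr) hgr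
  have he : ∀ α (x : gr α), e.symm x = DirectSum.lof K _ (fun α => gr α) α x := fun α x => by
    rw [LinearEquiv.symm_apply_eq]
    exact (DirectSum.coeLinearMap_lof gr α x).symm
  refine ⟨(gr 1).subtype.comp ((DirectSum.component K _ (fun α => gr α) 1).comp
    e.symm.toLinearMap), fun x hx => ?_, fun x hx => ?_⟩
  · have := he 0 ⟨x, hx⟩
    simp only [LinearMap.comp_apply, LinearEquiv.coe_coe] at this ⊢
    rw [this, DirectSum.component.of, dif_neg (by decide), map_zero]
  · have := he 1 ⟨x, hx⟩
    simp only [LinearMap.comp_apply, LinearEquiv.coe_coe] at this ⊢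
    rw [this, DirectSum.component.lof_self]
    rfl

variable {P : Type*} [AddCommGroup P] [Module K P] (π : M →ₗ[K] M)

/-- If `π` is the projection to the odd part: exchange of the arguments, with the sign rule. -/
def superFlip : (M →ₗ[K] M →ₗ[K] P) →ₗ[K] (M →ₗ[K] M →ₗ[K] P) where
  -- The coefficient is `1 - 2 = -1` when both arguments are odd, and 1 otherwise.
  toFun f := f.flip - (2 : K) • (f.compl₁₂ π π).flip
  map_add' f g := by ext; simp; abel
  map_smul' c f := by ext; simp [smul_sub, smul_smul, mul_comm]

theorem superFlip_apply (f : M →ₗ[K] M →ₗ[K] P) (x y : M) :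
    superFlip π f x y = f y x - (2 : K) • f (π y) (π x) := rfl

variable {π} (h0 : ∀ x ∈ gr 0, π x = 0) (h1 : ∀ x ∈ gr 1, π x = x)
include h0 h1

theorem superFlip_apply_of_mem {α β : ZMod 2} {x y : M} (hx : x ∈ gr α) (hy : y ∈ gr β)
    (f : M →ₗ[K] M →ₗ[K] P) : superFlip π f x y = sgn K (α * β) • f y x := by
  rw [superFlip_apply]
  obtain rfl | rfl := zmod_two_eq_zero_or_one α
  · simp [h0 x hx, sgn_zero]
  obtain rfl | rfl := zmod_two_eq_zero_or_one β
  · simp [h0 y hy, sgn_zero]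
  · rw [h1 x hx, h1 y hy, _root_.mul_one, sgn_one]; module

omit h0 h1 in
theorem sgn_mul_self (α : ZMod 2) : sgn K α * sgn K α = 1 := by
  obtain rfl | rfl := zmod_two_eq_zero_or_one α
  · simp [sgn_zero]
  · simp [sgn_one]

variable (hgr : DirectSum.IsInternal gr)
include hgr

theorem superFlip_superFlip (f : M →ₗ[K] M →ₗ[K] P) : superFlip π (superFlip π f) = f := by
  refine hom_ext_of_isInternal hgr fun α x hx => hom_ext_of_isInternal hgr fun β y hy => ?_
  rw [superFlip_apply_of_mem h0 h1 hx hy, superFlip_apply_of_mem h0 h1 hy hx, smul_smul,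
    mul_comm β, sgn_mul_self, one_smul]

end SuperFlip

/-! ### Splitting a trilinear map with vanishing antisymmetrization. -/

section Decomposition

variable {K : Type u} {M : Type v} [Field K] [AddCommGroup M] [Module K M]
  {gr : ZMod 2 → Submodule K M} {P : Type*} [AddCommGroup P] [Module K P]

/-- Here `s` and `t` play the adjacent transpositions and `s t s` the third one; `hx` says that the
antisymmetrizer `E` kills `x`. Then `p` is built from the `s`-orbits `{x, sx}`, `{tsx, stsx}`, `{tx,
stx}` and `q` from the `t`-orbits `{sx, tsx}`, `{x, tx}`, each with constant coefficients, which
gives the invariance. The coefficients are such that `p - q = x - E x / 6`. -/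
theorem eq_sub_of_involutions (h2 : (2 : K) ≠ 0) (h3 : (3 : K) ≠ 0) (s t : P →ₗ[K] P)
    (hs : ∀ x, s (s x) = x) (ht : ∀ x, t (t x) = x) (x : P)
    (hx : x - s x - t x - s (t (s x)) + s (t x) + t (s x) = 0) :
    let p := (6 : K)⁻¹ • ((3 : K) • x + (3 : K) • s x + t (s x) + s (t (s x)) - t x - s (t x))
    let q := (6 : K)⁻¹ • ((2 : K) • s x + (2 : K) • t (s x) - (2 : K) • x - (2 : K) • t x)
    x = p - q ∧ s p = p ∧ t q = q := by
  have h6 : (6 : K) ≠ 0 := by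
    have : (6 : K) = 2 * 3 := by norm_num
    rw [this]; exact mul_ne_zero h2 h3
  refine ⟨?_, ?_, ?_⟩
  · calc x = (6 : K)⁻¹ • ((6 : K) • x
          - (x - s x - t x - s (t (s x)) + s (t x) + t (s x))) := by
          rw [hx, sub_zero, inv_smul_smul₀ h6]
      _ = _ := by module
  · simp only [map_add, map_sub, map_smul, hs]
    module
  · simp only [map_add, map_sub, map_smul, ht]
    module

/-- A trilinear map with vanishing super-antisymmetrization is the difference of a map which is
supersymmetric in the first two arguments and one which is so in the last two. -/
theorem exists_supersymmetric_sub (h2 : (2 : K) ≠ 0) (h3 : (3 : K) ≠ 0)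
    (hgr : DirectSum.IsInternal gr) (F : M →ₗ[K] M →ₗ[K] M →ₗ[K] P)
    (hF : ∀ α β γ x y z, x ∈ gr α → y ∈ gr β → z ∈ gr γ →
      F x y z + sgn K (α * (β + γ)) • F y z x + sgn K (γ * (β + α)) • F z x y
        - sgn K (α * β) • F y x z - sgn K (α * (β + γ) + β * γ) • F z y x
        - sgn K (γ * β) • F x z y = 0) :
    ∃ p q : M →ₗ[K] M →ₗ[K] M →ₗ[K] P, F = p - q ∧
      (∀ α β x y z, x ∈ gr α → y ∈ gr β → p x y z = sgn K (α * β) • p y x z) ∧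
      (∀ β γ x y z, y ∈ gr β → z ∈ gr γ → q x y z = sgn K (β * γ) • q x z y) ∧
      (∀ Q : Submodule K P, (∀ x y z, F x y z ∈ Q) → ∀ x y z, p x y z ∈ Q ∧ q x y z ∈ Q) ∧
      (∀ Q : ZMod 2 → Submodule K P,
        (∀ α β γ x y z, x ∈ gr α → y ∈ gr β → z ∈ gr γ → F x y z ∈ Q (α + β + γ)) →
        ∀ α β γ x y z, x ∈ gr α → y ∈ gr β → z ∈ gr γ →
          p x y z ∈ Q (α + β + γ) ∧ q x y z ∈ Q (α + β + γ)) := by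
  obtain ⟨π, h0, h1⟩ := exists_oddProj hgr
  let s : (M →ₗ[K] M →ₗ[K] M →ₗ[K] P) →ₗ[K] (M →ₗ[K] M →ₗ[K] M →ₗ[K] P) := superFlip π
  let t : (M →ₗ[K] M →ₗ[K] M →ₗ[K] P) →ₗ[K] (M →ₗ[K] M →ₗ[K] M →ₗ[K] P) :=
    LinearMap.compRight K (superFlip π)
  have hs : ∀ G α β x y z, x ∈ gr α → y ∈ gr β → s G x y z = sgn K (α * β) • G y x z := by
    intro G α β x y z hx hy
    simp only [s]
    rw [superFlip_apply_of_mem h0 h1 hx hy]; rfl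
  have ht : ∀ G β γ x y z, y ∈ gr β → z ∈ gr γ → t G x y z = sgn K (β * γ) • G x z y :=
    fun G β γ x y z hy hz => superFlip_apply_of_mem h0 h1 hy hz (G x)
  have hss : ∀ G, s (s G) = G := fun G => superFlip_superFlip h0 h1 hgr G
  have htt : ∀ G, t (t G) = G := fun G =>
    LinearMap.ext fun x => superFlip_superFlip h0 h1 hgr (G x)
  -- On homogeneous arguments the six words in `s` and `t` produce the six signed terms of `hF`; the
  -- signs are compared for each choice of parities.
  have hE : F - s F - t F - s (t (s F)) + s (t F) + t (s F) = 0 := by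
    refine hom_ext_of_isInternal hgr fun α x hx => hom_ext_of_isInternal hgr fun β y hy =>
      hom_ext_of_isInternal hgr fun γ z hz => ?_
    simp only [LinearMap.add_apply, LinearMap.sub_apply, LinearMap.zero_apply]
    rw [hs _ _ _ _ _ _ hx hy, ht _ _ _ _ _ _ hy hz, hs _ _ _ _ _ _ hx hy,
      ht _ _ _ _ _ _ hx hz, hs _ _ _ _ _ _ hy hz, hs _ _ _ _ _ _ hx hy,
      ht _ _ _ _ _ _ hx hz, ht _ _ _ _ _ _ hy hz, hs _ _ _ _ _ _ hx hz, ← hF α β γ x y z hx hy hz]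
    obtain rfl | rfl := zmod_two_eq_zero_or_one α
    all_goals obtain rfl | rfl := zmod_two_eq_zero_or_one β
    all_goals obtain rfl | rfl := zmod_two_eq_zero_or_one γ
    all_goals
      simp only [mul_zero, add_zero, zero_add, _root_.mul_one,
        CharTwo.add_self_eq_zero, sgn_zero, sgn_one]
      module
  obtain ⟨hFpq, hsp, htq⟩ := eq_sub_of_involutions h2 h3 s t hss htt F hE
  let p := (6 : K)⁻¹ • ((3 : K) • F + (3 : K) • s F + t (s F) + s (t (s F)) - t F - s (t F))
  let q := (6 : K)⁻¹ • ((2 : K) • s F + (2 : K) • t (s F) - (2 : K) • F - (2 : K) • t F)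
  refine ⟨p, q, hFpq, fun α β x y z hx hy => ?_, fun β γ x y z hy hz => ?_, fun Q hQ => ?_,
    fun Q hQ => ?_⟩
  · exact (LinearMap.congr_fun₂ (LinearMap.congr_fun hsp x) y z).symm.trans (hs p α β x y z hx hy)
  · exact (LinearMap.congr_fun₂ (LinearMap.congr_fun htq x) y z).symm.trans (ht q β γ x y z hy hz)
  -- `p` and `q` are combinations of `F`, `s F`, `t F`, `t (s F)`, `s (t F)` and `s (t (s F))`, so
  -- it is enough that `s` and `t` preserve values in `Q`.
  · have hs' : ∀ G : M →ₗ[K] M →ₗ[K] M →ₗ[K] P, (∀ x y z, G x y z ∈ Q) →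
        ∀ x y z, s G x y z ∈ Q := fun G hG x y z =>
      sub_mem (hG _ _ _) (Q.smul_mem _ (hG _ _ _))
    have ht' : ∀ G : M →ₗ[K] M →ₗ[K] M →ₗ[K] P, (∀ x y z, G x y z ∈ Q) →
        ∀ x y z, t G x y z ∈ Q := fun G hG x y z =>
      sub_mem (hG _ _ _) (Q.smul_mem _ (hG _ _ _))
    have e1 := hs' F hQ
    have e2 := ht' F hQ
    have e3 := ht' _ e1
    have e4 := hs' _ e2
    have e5 := hs' _ e3
    intro x y z
    exact ⟨Q.smul_mem _ (sub_mem (sub_mem (add_mem (add_mem (add_mem (Q.smul_mem _ (hQ _ _ _))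
      (Q.smul_mem _ (e1 _ _ _))) (e3 _ _ _)) (e5 _ _ _)) (e2 _ _ _)) (e4 _ _ _)),
      Q.smul_mem _ (sub_mem (sub_mem (add_mem (Q.smul_mem _ (e1 _ _ _))
      (Q.smul_mem _ (e3 _ _ _))) (Q.smul_mem _ (hQ _ _ _))) (Q.smul_mem _ (e2 _ _ _)))⟩
  · have hs' : ∀ G : M →ₗ[K] M →ₗ[K] M →ₗ[K] P,
        (∀ α β γ x y z, x ∈ gr α → y ∈ gr β → z ∈ gr γ → G x y z ∈ Q (α + β + γ)) →
        ∀ α β γ x y z, x ∈ gr α → y ∈ gr β → z ∈ gr γ → s G x y z ∈ Q (α + β + γ) := by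
      intro G hG α β γ x y z hx hy hz
      rw [hs _ _ _ _ _ _ hx hy, add_comm α]
      exact (Q _).smul_mem _ (hG _ _ _ _ _ _ hy hx hz)
    have ht' : ∀ G : M →ₗ[K] M →ₗ[K] M →ₗ[K] P,
        (∀ α β γ x y z, x ∈ gr α → y ∈ gr β → z ∈ gr γ → G x y z ∈ Q (α + β + γ)) →
        ∀ α β γ x y z, x ∈ gr α → y ∈ gr β → z ∈ gr γ → t G x y z ∈ Q (α + β + γ) := by
      intro G hG α β γ x y z hx hy hz
      rw [ht _ _ _ _ _ _ hy hz, add_right_comm]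
      exact (Q _).smul_mem _ (hG _ _ _ _ _ _ hx hz hy)
    have e1 := hs' F hQ
    have e2 := ht' F hQ
    have e3 := ht' _ e1
    have e4 := hs' _ e2
    have e5 := hs' _ e3
    intro α β γ x y z hx hy hz
    have e0 := hQ α β γ x y z hx hy hz
    replace e1 := e1 α β γ x y z hx hy hz
    replace e2 := e2 α β γ x y z hx hy hz
    replace e3 := e3 α β γ x y z hx hy hz
    replace e4 := e4 α β γ x y z hx hy hz
    replace e5 := e5 α β γ x y z hx hy hz
    exact ⟨(Q _).smul_mem _ (sub_mem (sub_mem (add_mem (add_mem (add_mem ((Q _).smul_mem _ e0)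
      ((Q _).smul_mem _ e1)) e3) e5) e2) e4),
      (Q _).smul_mem _ (sub_mem (sub_mem (add_mem ((Q _).smul_mem _ e1)
      ((Q _).smul_mem _ e3)) ((Q _).smul_mem _ e0)) ((Q _).smul_mem _ e2))⟩

end Decomposition

/-! ### The components of low degree of `V(M)` -/

namespace V

variable {K : Type u} {M : Type v} [Field K] [AddCommGroup M] [Module K M]
  (gr : ZMod 2 → Submodule K M)

/-- The inclusion of `Sⁿ⁺¹(M)` in `V(M)`, for `n + 1 ≤ 3`. -/
def ofSym (n : ℕ) (h : n + 1 ≤ 3) : SuperSym.degree gr (n + 1) →ₗ[K] V gr :=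
  ((symData gr).of (n + 1)).comp
    ((symData gr).lowEquiv (n := n + 1) h).symm.toLinearMap

/-- The projection of `V(M)` to `Sⁿ⁺¹(M)`, for `n + 1 ≤ 3`. -/
def toSym (n : ℕ) (h : n + 1 ≤ 3) : V gr →ₗ[K] SuperSym gr :=
  (SuperSym.degree gr (n + 1)).subtype.comp
    (((symData gr).lowEquiv (n := n + 1) h).toLinearMap.comp
      (DirectSum.component K ℕ (fun n => ((symData gr).level n : Type _)) (n + 1)))

theorem ι_eq_ofSym (x : M) :
    V.ι gr x = ofSym gr 0 (by decide) ⟨SuperSym.ι gr x, SuperSym.ι_mem x⟩ := rfl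

theorem of_eq_ofSym (n : ℕ) (h : n + 1 ≤ 3) (x : (symData gr).level (n + 1)) :
    (symData gr).of (n + 1) x = ofSym gr n h ((symData gr).lowEquiv (n := n + 1) h x) := by
  refine congrArg ((symData gr).of (n + 1)) ?_
  exact (((symData gr).lowEquiv (n := n + 1) h).symm_apply_apply x).symm

theorem toSym_ofSym (n : ℕ) (h : n + 1 ≤ 3) (a : SuperSym.degree gr (n + 1)) :
    toSym gr n h (ofSym gr n h a) = a := by
  have : DirectSum.component K ℕ (fun n => ((symData gr).level n : Type _)) (n + 1)
      (ofSym gr n h a) = ((symData gr).lowEquiv (n := n + 1) h).symm a :=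
    DirectSum.component.lof_self _ _ _
  refine congrArg Subtype.val (a₂ := a) ((congrArg _ this).trans ?_)
  exact ((symData gr).lowEquiv (n := n + 1) h).apply_symm_apply a

theorem toSym_of_ne (n : ℕ) (h : n + 1 ≤ 3) {m : ℕ} (hm : m ≠ n + 1)
    (x : (symData gr).level m) : toSym gr n h ((symData gr).of m x) = 0 := by
  have : DirectSum.component K ℕ (fun n => ((symData gr).level n : Type _)) (n + 1)
      ((symData gr).of m x) = 0 := by rw [DirectSum.component.of, dif_neg hm]
  exact (congrArg _ this).trans (map_zero ((SuperSym.degree gr (n + 1)).subtype.comp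
    ((symData gr).lowEquiv (n := n + 1) h).toLinearMap))

theorem toSym_mem (n : ℕ) (h : n + 1 ≤ 3) (v : V gr) : toSym gr n h v ∈ SuperSym.degree gr (n + 1) :=
  Subtype.property _

theorem mulMap_ofSym (i j : ℕ) (h : i + 1 + (j + 1) ≤ 3) (a : SuperSym.degree gr (i + 1))
    (b : SuperSym.degree gr (j + 1)) :
    (symData gr).mulMap (ofSym gr i (by omega) a) (ofSym gr j (by omega) b)
      = ofSym gr (i + 1 + j) h ⟨a * b, SuperSym.mul_mem_degree (i := i + 1) (j := j + 1) a.2 b.2⟩ :=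
  (symData gr).of_mul_of_low (i := i) (j := j) h a b

theorem ι_mul_ι (x y : M) : (symData gr).mulMap (V.ι gr x) (V.ι gr y)
    = ofSym gr 1 (by decide) ⟨SuperSym.ι gr x * SuperSym.ι gr y,
        SuperSym.mul_mem_degree (SuperSym.ι_mem x) (SuperSym.ι_mem y)⟩ := by
  rw [ι_eq_ofSym, ι_eq_ofSym, mulMap_ofSym gr 0 0 (by decide)]

theorem ι_mul_ι_mul_ι (x y z : M) :
    (symData gr).mulMap ((symData gr).mulMap (V.ι gr x) (V.ι gr y)) (V.ι gr z)
    = ofSym gr 2 (by decide) ⟨SuperSym.ι gr x * SuperSym.ι gr y * SuperSym.ι gr z,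
        SuperSym.mul_mem_degree (SuperSym.mul_mem_degree (SuperSym.ι_mem x) (SuperSym.ι_mem y))
          (SuperSym.ι_mem z)⟩ := by
  rw [ι_mul_ι, ι_eq_ofSym, mulMap_ofSym gr 1 0 (by decide)]

theorem ι_assoc (x y z : M) :
    (symData gr).mulMap ((symData gr).mulMap (V.ι gr x) (V.ι gr y)) (V.ι gr z)
    = (symData gr).mulMap (V.ι gr x) ((symData gr).mulMap (V.ι gr y) (V.ι gr z)) := by
  rw [ι_mul_ι_mul_ι, ι_mul_ι, ι_eq_ofSym, mulMap_ofSym gr 0 1 (by decide)]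
  congr 1
  exact Subtype.ext (mul_assoc _ _ _)

variable {gr}

theorem ι_supercomm {α β : ZMod 2} {x y : M} (hx : x ∈ gr α) (hy : y ∈ gr β) :
    (symData gr).mulMap (V.ι gr x) (V.ι gr y)
      = sgn K (α * β) • (symData gr).mulMap (V.ι gr y) (V.ι gr x) := by
  rw [ι_mul_ι, ι_mul_ι, ← map_smul]
  congr 1
  exact Subtype.ext (SuperSym.ι_mul_ι hx hy)

theorem degree_one_le {Q : Submodule K (V gr)} (hQ : ∀ x, V.ι gr x ∈ Q) :
    (symData gr).degree 1 ≤ Q := by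
  rintro _ ⟨x, rfl⟩
  rw [of_eq_ofSym gr 0 (by decide)]
  -- The spanning lemma concerns submodules of `S(M)`, so the preimage of `Q` is pushed forward
  -- along the inclusion of the component.
  have := SuperSym.degree_one_le (Q := (Q.comap (ofSym gr 0 (by decide))).map
    (SuperSym.degree gr 1).subtype) (fun x => ⟨_, hQ x, rfl⟩)
    ((symData gr).lowEquiv (n := 1) (by decide : 1 ≤ 3) x).2
  obtain ⟨y, hy, hxy⟩ := this
  rw [← Subtype.ext hxy]
  exact hy

theorem degree_two_le {Q : Submodule K (V gr)}
    (hQ : ∀ x y, (symData gr).mulMap (V.ι gr x) (V.ι gr y) ∈ Q) :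
    (symData gr).degree 2 ≤ Q := by
  rintro _ ⟨x, rfl⟩
  rw [of_eq_ofSym gr 1 (by decide)]
  have := SuperSym.degree_two_le (Q := (Q.comap (ofSym gr 1 (by decide))).map
    (SuperSym.degree gr 2).subtype) (fun x y => ⟨_, (ι_mul_ι gr x y).symm ▸ hQ x y, rfl⟩)
    ((symData gr).lowEquiv (n := 2) (by decide : 2 ≤ 3) x).2
  obtain ⟨y, hy, hxy⟩ := this
  rw [← Subtype.ext hxy]
  exact hy

theorem degree_three_le {Q : Submodule K (V gr)}
    (hQ : ∀ x y z,
      (symData gr).mulMap ((symData gr).mulMap (V.ι gr x) (V.ι gr y)) (V.ι gr z) ∈ Q) :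
    (symData gr).degree 3 ≤ Q := by
  rintro _ ⟨x, rfl⟩
  rw [of_eq_ofSym gr 2 (by decide)]
  have := SuperSym.degree_three_le (Q := (Q.comap (ofSym gr 2 (by decide))).map
    (SuperSym.degree gr 3).subtype)
    (fun x y z => ⟨_, (ι_mul_ι_mul_ι gr x y z).symm ▸ hQ x y z, rfl⟩)
    ((symData gr).lowEquiv (n := 3) (by decide : 3 ≤ 3) x).2
  obtain ⟨y, hy, hxy⟩ := this
  rw [← Subtype.ext hxy]
  exact hy

theorem ι_mem_parity {α : ZMod 2} {x : M} (hx : x ∈ gr α) :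
    V.ι gr x ∈ (symData gr).parity α := by
  refine (symData gr).of_mem_parity ?_
  rw [(symData gr).of_levelPar_low (by decide : 1 ≤ 3)]
  refine Submodule.mem_comap.2 ?_
  have := ((symData gr).lowEquiv (n := 1) (by decide : 1 ≤ 3)).apply_symm_apply
    (⟨SuperSym.ι gr x, SuperSym.ι_mem x⟩ : SuperSym.degree gr 1)
  exact this.symm ▸ SuperSym.ι_mem_degreePar hx

theorem toSym_of_mem_parity (n : ℕ) (h : n + 1 ≤ 3) {γ : ZMod 2} {v : V gr}
    (hv : v ∈ (symData gr).parity γ) :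
    (⟨toSym gr n h v, toSym_mem gr n h v⟩ : SuperSym.degree gr (n + 1))
      ∈ SuperSym.degreePar gr (n + 1) γ := by
  have := (symData gr).component_mem_levelPar hv (n + 1)
  rw [(symData gr).of_levelPar_low (n := n + 1) h] at this
  exact this

variable (gr)

/-- Projecting to `M` allows a correction to be given by one formula on all of `V(M)`. -/
theorem exists_toM : ∃ g : V gr →ₗ[K] M, (∀ x, g (V.ι gr x) = x) ∧
    (∀ m, m ≠ 1 → ∀ x, g ((symData gr).of m x) = 0) ∧
    ∀ γ, ∀ v ∈ (symData gr).parity γ, g v ∈ gr γ := by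
  obtain ⟨g, hg⟩ := SuperSym.exists_lift_one gr
  refine ⟨g.comp (toSym gr 0 (by decide)), fun x => ?_, fun m hm x => ?_, fun γ v hv => ?_⟩
  · rw [ι_eq_ofSym, LinearMap.comp_apply, toSym_ofSym, hg]
  · rw [LinearMap.comp_apply, toSym_of_ne gr 0 _ hm, map_zero]
  · exact SuperSym.degreePar_one_le (Q := (gr γ).comap g) (fun x hx => by simpa [hg] using hx)
      (toSym_of_mem_parity 0 _ hv)

end V

/-! ### The deformation of the product of `V(M)` -/

namespace AkivisSuperalgebra

variable {K : Type u} {M : Type v} [Field K] [AddCommGroup M] [Module K M]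
  (X : AkivisSuperalgebra K M)

variable {P : Type*} [AddCommGroup P] [Module K P]

/-- If `c = 1 / 2` and `B` is the supercommutative product of elements of `M`: the trilinear map
which the difference of the corrections of the products `(x y) z` and `x (y z)` has to be. -/
def defect (c : K) (ι : M →ₗ[K] P) (B : M →ₗ[K] M →ₗ[K] P) : M →ₗ[K] M →ₗ[K] M →ₗ[K] P :=
  -- `R C` sends `(x, y, z)` to `C x [y, z]`.
  let R : (M →ₗ[K] M →ₗ[K] P) → (M →ₗ[K] M →ₗ[K] M →ₗ[K] P) := fun C =>
    { toFun := fun x => X.bracket.compr₂ (C x)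
      map_add' := by intros; ext; simp
      map_smul' := by intros; ext; simp }
  X.A.compr₂ (LinearMap.compRight K ι) - c • X.bracket.compr₂ B
    - (c * c) • X.bracket.compr₂ (X.bracket.compr₂ ι)
    + c • R B + (c * c) • R (X.bracket.compr₂ ι)

theorem defect_apply (c : K) (ι : M →ₗ[K] P) (B : M →ₗ[K] M →ₗ[K] P) (x y z : M) :
    X.defect c ι B x y z =
      ι (X.A x y z) - c • B (X.bracket x y) z - (c * c) • ι (X.bracket (X.bracket x y) z)
      + c • B x (X.bracket y z) + (c * c) • ι (X.bracket x (X.bracket y z)) := rfl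

/-- The terms in `B` cancel because `B` is supercommutative while the bracket is
superanticommutative. Each double bracket `[[x, y], z]` of the Akivis identity arises four times
with coefficient `-c * c = -1/4`, so the sum is the right side of that identity minus its left side.
-/
theorem defect_alternating {c : K} (hc : 2 * c = 1) (ι : M →ₗ[K] P) (B : M →ₗ[K] M →ₗ[K] P)
    (hB : ∀ α β x y, x ∈ X.gr α → y ∈ X.gr β → B x y = sgn K (α * β) • B y x)
    (α β γ : ZMod 2) (x y z : M) (hx : x ∈ X.gr α)
    (hy : y ∈ X.gr β) (hz : z ∈ X.gr γ) :
    X.defect c ι B x y z + sgn K (α * (β + γ)) • X.defect c ι B y z x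
      + sgn K (γ * (β + α)) • X.defect c ι B z x y
      - sgn K (α * β) • X.defect c ι B y x z
      - sgn K (α * (β + γ) + β * γ) • X.defect c ι B z y x
      - sgn K (γ * β) • X.defect c ι B x z y = 0 := by
  have hak := congrArg ι (X.akivis α β γ x y z hx hy hz)
  have bxy := X.bracket_mem _ _ _ _ hx hy
  have byz := X.bracket_mem _ _ _ _ hy hz
  have bzx := X.bracket_mem _ _ _ _ hz hx
  rw [← sub_eq_zero] at hak
  -- Writing the coefficient 1 of the Akivis identity as `4 c²` makes both sides polynomial in `c`,
  -- so that `module` can compare them.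
  have hcc : 2 * c * (2 * c) = 1 := by rw [hc, _root_.mul_one]
  refine Eq.trans ?_ (neg_eq_zero.2 hak)
  rw [← one_smul K (ι (_ + _)), ← hcc]
  simp only [map_add, map_sub, map_smul, defect_apply]
  -- All brackets are brought to `[x, y]`, `[y, z]`, `[z, x]`, placed in the left slot.
  rw [X.bracket_anticomm _ _ _ _ hy hx, X.bracket_anticomm _ _ _ _ hz hy,
    X.bracket_anticomm _ _ _ _ hx hz]
  simp only [map_neg, map_smul, LinearMap.neg_apply, LinearMap.smul_apply]
  rw [X.bracket_anticomm _ _ _ _ hx byz, X.bracket_anticomm _ _ _ _ hz bxy,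
    X.bracket_anticomm _ _ _ _ hy bzx, hB _ _ _ _ hx byz, hB _ _ _ _ hz bxy,
    hB _ _ _ _ hy bzx]
  simp only [map_neg, map_smul]
  obtain rfl | rfl := zmod_two_eq_zero_or_one α
  all_goals obtain rfl | rfl := zmod_two_eq_zero_or_one β
  all_goals obtain rfl | rfl := zmod_two_eq_zero_or_one γ
  all_goals
    simp only [mul_zero, add_zero, zero_add, _root_.mul_one,
      CharTwo.add_self_eq_zero, sgn_zero, sgn_one]
    module

end AkivisSuperalgebra

/-! ### Existence of a correction. -/

namespace AkivisSuperalgebra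

variable {K : Type u} {M : Type v} [Field K] [AddCommGroup M] [Module K M]
  (X : AkivisSuperalgebra K M)

/-- The properties of a bilinear map whose sum with the product of `V(M)` is a product satisfying
the relations of the universal enveloping superalgebra of `X`. -/
structure IsCorrection (c : V X.gr →ₗ[K] V X.gr →ₗ[K] V X.gr) : Prop where
  eq_zero : ∀ i j a b, i = 0 ∨ j = 0 ∨ 3 < i + j →
    c ((symData X.gr).of i a) ((symData X.gr).of j b) = 0
  ι_ι : ∀ x y, c (V.ι X.gr x) (V.ι X.gr y) = (2 : K)⁻¹ • V.ι X.gr (X.bracket x y)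
  sub_eq : ∀ x y z, c ((symData X.gr).mulMap (V.ι X.gr x) (V.ι X.gr y)) (V.ι X.gr z)
      - c (V.ι X.gr x) ((symData X.gr).mulMap (V.ι X.gr y) (V.ι X.gr z))
    = X.defect (2 : K)⁻¹ (V.ι X.gr)
        ((symData X.gr).mulMap.compl₁₂ (V.ι X.gr) (V.ι X.gr)) x y z
  -- The correction lowers the total degree by at least one; this is what makes it vanish in the
  -- associated graded algebra.
  mem_filtration : ∀ i j n a b, i + j = n + 1 →
    c ((symData X.gr).of i a) ((symData X.gr).of j b) ∈ (symData X.gr).filtration n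
  mem_parity : ∀ α β a b, a ∈ (symData X.gr).parity α → b ∈ (symData X.gr).parity β →
    c a b ∈ (symData X.gr).parity (α + β)

theorem ι_mem_filtration_one (x : M) : V.ι X.gr x ∈ (symData X.gr).filtration 1 :=
  (symData X.gr).degree_le_filtration le_rfl ⟨_, rfl⟩

theorem defect_mem_filtration (c : K) (x y z : M) :
    X.defect c (V.ι X.gr) ((symData X.gr).mulMap.compl₁₂ (V.ι X.gr) (V.ι X.gr)) x y z
      ∈ (symData X.gr).filtration 2 := by
  have h1 : ∀ x, V.ι X.gr x ∈ (symData X.gr).filtration 2 := fun x =>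
    (symData X.gr).filtration_mono (by decide) (X.ι_mem_filtration_one x)
  have h2 : ∀ x y, (symData X.gr).mulMap (V.ι X.gr x) (V.ι X.gr y)
      ∈ (symData X.gr).filtration 2 := fun x y =>
    (symData X.gr).mul_mem_filtration 1 1 _ _ (X.ι_mem_filtration_one x)
      (X.ι_mem_filtration_one y)
  rw [defect_apply]
  exact add_mem (add_mem (sub_mem (sub_mem (h1 _) (Submodule.smul_mem _ _ (h2 _ _)))
    (Submodule.smul_mem _ _ (h1 _))) (Submodule.smul_mem _ _ (h2 _ _)))
    (Submodule.smul_mem _ _ (h1 _))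

theorem defect_mem_parity (c : K) (α β γ : ZMod 2) (x y z : M) (hx : x ∈ X.gr α)
    (hy : y ∈ X.gr β) (hz : z ∈ X.gr γ) :
    X.defect c (V.ι X.gr) ((symData X.gr).mulMap.compl₁₂ (V.ι X.gr) (V.ι X.gr)) x y z
      ∈ (symData X.gr).parity (α + β + γ) := by
  have hm : ∀ {α β : ZMod 2} {x y : M}, x ∈ X.gr α → y ∈ X.gr β →
      (symData X.gr).mulMap (V.ι X.gr x) (V.ι X.gr y) ∈ (symData X.gr).parity (α + β) :=
    fun hx hy => symData_isSuper.mul_mem_parity (V.ι_mem_parity hx) (V.ι_mem_parity hy)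
  have hb := fun {α β x y} => X.bracket_mem α β x y
  have hxyz := X.A_mem _ _ _ _ _ _ hx hy hz
  have e := add_assoc α β γ
  rw [defect_apply]
  refine add_mem (add_mem (sub_mem (sub_mem (V.ι_mem_parity hxyz)
    (Submodule.smul_mem _ _ (hm (hb hx hy) hz)))
    (Submodule.smul_mem _ _ (V.ι_mem_parity (hb (hb hx hy) hz)))) ?_) ?_
  · rw [e]; exact Submodule.smul_mem _ _ (hm hx (hb hy hz))
  · rw [e]; exact Submodule.smul_mem _ _ (V.ι_mem_parity (hb hx (hb hy hz)))

/-- The splitting `p - q` of the defect supplies the values in bidegrees (2,1) and (1,2); the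
symmetries of `p` and `q` let them factor through `S²(M)`. -/
theorem exists_isCorrection (h2 : (2 : K) ≠ 0) (h3 : (3 : K) ≠ 0) :
    ∃ c, X.IsCorrection c := by
  obtain ⟨p, q, hF, hp, hq, hS, hQ⟩ := exists_supersymmetric_sub h2 h3 X.isInternal _
    (X.defect_alternating (mul_inv_cancel₀ h2) (V.ι X.gr)
      ((symData X.gr).mulMap.compl₁₂ (V.ι X.gr) (V.ι X.gr))
      fun α β x y hx hy => V.ι_supercomm hx hy)
  replace hS := hS _ (X.defect_mem_filtration _)
  replace hQ := hQ _ (X.defect_mem_parity _)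
  -- The symmetric pair `y, z` comes first, so that `q'` factors through `S²(M)`.
  let q' : M →ₗ[K] M →ₗ[K] M →ₗ[K] V X.gr := LinearMap.lflip.toLinearMap.comp q.flip
  obtain ⟨p2, hp2⟩ := SuperSym.exists_lift_two (gr := X.gr) p fun α β x y hx hy =>
    LinearMap.ext fun z => hp α β x y z hx hy
  obtain ⟨q2, hq2⟩ := SuperSym.exists_lift_two (gr := X.gr) q' fun β γ y z hy hz =>
    LinearMap.ext fun x => hq β γ x y z hy hz
  have hq2' : ∀ x y z, q2 (SuperSym.ι X.gr y * SuperSym.ι X.gr z) x = q x y z := fun x y z => by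
    rw [hq2]; rfl
  obtain ⟨g, hgι, hg0, hgpar⟩ := V.exists_toM X.gr
  let s := V.toSym X.gr 1 (by decide)
  have hsι : ∀ x, s (V.ι X.gr x) = 0 := fun x => V.toSym_of_ne X.gr 1 _ (by decide) _
  have hsμ : ∀ x y, s ((symData X.gr).mulMap (V.ι X.gr x) (V.ι X.gr y))
      = SuperSym.ι X.gr x * SuperSym.ι X.gr y := fun x y => by
    rw [V.ι_mul_ι]; exact V.toSym_ofSym _ _ _ _
  have hgμ : ∀ x y, g ((symData X.gr).mulMap (V.ι X.gr x) (V.ι X.gr y)) = 0 := fun x y => by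
    rw [V.ι_mul_ι]; exact hg0 2 (by decide) _
  have hs0 : ∀ m, m ≠ 2 → ∀ x, s ((symData X.gr).of m x) = 0 := fun m hm x =>
    V.toSym_of_ne X.gr 1 _ hm x
  have hp2S : ∀ v z, p2 (s v) z ∈ (symData X.gr).filtration 2 := fun v z =>
    SuperSym.degree_two_le (Q := ((symData X.gr).filtration 2).comap (p2.flip z))
      (fun x y => by simpa [hp2] using (hS x y z).1) (V.toSym_mem X.gr 1 _ v)
  have hq2S : ∀ v z, q2 (s v) z ∈ (symData X.gr).filtration 2 := fun v z =>
    SuperSym.degree_two_le (Q := ((symData X.gr).filtration 2).comap (q2.flip z))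
      (fun x y => by simpa [hq2'] using (hS z x y).2) (V.toSym_mem X.gr 1 _ v)
  have hp2Q : ∀ γ δ v z, v ∈ (symData X.gr).parity γ → z ∈ X.gr δ →
      p2 (s v) z ∈ (symData X.gr).parity (γ + δ) := fun γ δ v z hv hz =>
    SuperSym.degreePar_two_le (Q := ((symData X.gr).parity (γ + δ)).comap (p2.flip z))
      (fun α β x y hx hy h => by
        subst h
        simpa [hp2] using (hQ α β δ x y z hx hy hz).1) (V.toSym_of_mem_parity 1 _ hv)
  have hq2Q : ∀ γ δ v z, v ∈ (symData X.gr).parity γ → z ∈ X.gr δ →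
      q2 (s v) z ∈ (symData X.gr).parity (δ + γ) := fun γ δ v z hv hz =>
    SuperSym.degreePar_two_le (Q := ((symData X.gr).parity (δ + γ)).comap (q2.flip z))
      (fun α β x y hx hy h => by
        subst h
        simpa [hq2', add_assoc] using (hQ δ α β z x y hz hx hy).2) (V.toSym_of_mem_parity 1 _ hv)
  -- With `g` the projection to `M` and `s` that to `S²(M)`, the three terms live in bidegrees
  -- (1,1), (2,1) and (1,2) respectively.
  let c : V X.gr →ₗ[K] V X.gr →ₗ[K] V X.gr :=
    (2 : K)⁻¹ • (X.bracket.compr₂ (V.ι X.gr)).compl₁₂ g g + p2.compl₁₂ s g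
      + (q2.compl₁₂ s g).flip
  have hc : ∀ v w, c v w = (2 : K)⁻¹ • V.ι X.gr (X.bracket (g v) (g w)) + p2 (s v) (g w)
      + q2 (s w) (g v) := fun _ _ => rfl
  refine ⟨c, fun i j a b hij => ?_, fun x y => ?_, fun x y z => ?_, fun i j n a b hij => ?_,
    fun α β a b ha hb => ?_⟩
  · rw [hc]
    rcases eq_or_ne i 1 with rfl | hi
    · rw [hs0 1 (by decide) a, hg0 j (by omega), hs0 j (by omega)]; simp
    · rw [hg0 i hi]
      rcases eq_or_ne i 2 with rfl | hi
      · rw [hg0 j (by omega)]; simp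
      · rw [hs0 i hi]; simp
  · rw [hc]
    simp [hgι, hsι]
  · rw [hc, hc, hF]
    simp [hgι, hsι, hgμ, hsμ, hp2, hq2']
    rfl
  · rw [hc]
    refine add_mem (add_mem (Submodule.smul_mem _ _ ?_) ?_) ?_
    · by_cases h : i = 1 ∧ j = 1
      · exact (symData X.gr).filtration_mono (by omega) (X.ι_mem_filtration_one _)
      · rcases eq_or_ne i 1 with rfl | hi
        · rw [hg0 j (by tauto)]; simp
        · rw [hg0 i hi]; simp
    · by_cases h : i = 2 ∧ j = 1
      · exact (symData X.gr).filtration_mono (by omega) (hp2S _ _)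
      · rcases eq_or_ne i 2 with rfl | hi
        · rw [hg0 j (by tauto)]; simp
        · rw [hs0 i hi]; simp
    · by_cases h : i = 1 ∧ j = 2
      · exact (symData X.gr).filtration_mono (by omega) (hq2S _ _)
      · rcases eq_or_ne i 1 with rfl | hi
        · rw [hs0 j (by tauto)]; simp
        · rw [hg0 i hi]; simp
  · rw [hc]
    have hga := hgpar _ _ ha
    have hgb := hgpar _ _ hb
    exact add_mem (add_mem (Submodule.smul_mem _ _ (V.ι_mem_parity (X.bracket_mem _ _ _ _ hga hgb)))
      (hp2Q _ _ _ _ ha hgb)) (hq2Q _ _ _ _ hb hga)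

theorem defect_trivial {P : Type*} [AddCommGroup P] [Module K P] (c : K) (ι : M →ₗ[K] P)
    (B : M →ₗ[K] M →ₗ[K] P) (x y z : M) : X.trivial.defect c ι B x y z = 0 := by
  rw [defect_apply]
  simp [AkivisSuperalgebra.trivial]

/-- The product of `V(M)` itself satisfies the relations of the trivial Akivis superalgebra. -/
theorem isCorrection_zero : X.trivial.IsCorrection 0 where
  eq_zero _ _ _ _ _ := rfl
  ι_ι x y := by
    change 0 = (2 : K)⁻¹ • V.ι X.gr 0
    simp
  sub_eq x y z := by
    rw [defect_trivial]
    exact sub_self (0 : V X.gr)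
  mem_filtration _ _ _ _ _ _ := zero_mem _
  mem_parity _ _ _ _ _ _ := zero_mem _

end AkivisSuperalgebra

/-! ### Multiplicative maps for a product modified in low degrees. -/

namespace TruncData

variable {K : Type u} [Field K] (D : TruncData.{u, w} K)
  {P : Type*} [AddCommGroup P] [Module K P] (μ : P →ₗ[K] P →ₗ[K] P)

theorem lift_of_lowEquiv_symm (f : ∀ n, D.comp n →ₗ[K] P) {n : ℕ} (h : n ≤ D.d) (a : D.comp n) :
    D.lift μ f (D.of n ((D.lowEquiv h).symm a)) = f n a := by
  rw [lift_of_low D μ f h, LinearEquiv.apply_symm_apply]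

/-- A linear map given by its values in degrees `≤ d` is multiplicative for a product which is
modified in degrees `≤ d` as soon as it is so in these degrees. -/
theorem lift_mul_add (f : ∀ n, D.comp n →ₗ[K] P)
    (hl : ∀ v, μ (f 0 (D.unitEquiv.symm 1)) v = v) (hr : ∀ v, μ v (f 0 (D.unitEquiv.symm 1)) = v)
    (c : D.Alg →ₗ[K] D.Alg →ₗ[K] D.Alg)
    (hc : ∀ i j a b, i = 0 ∨ j = 0 ∨ D.d < i + j → c (D.of i a) (D.of j b) = 0)
    (hlow : ∀ i j, i + 1 + (j + 1) ≤ D.d → ∀ a b,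
      D.lift μ f (D.mulMap (D.of (i + 1) a) (D.of (j + 1) b) + c (D.of (i + 1) a) (D.of (j + 1) b))
        = μ (D.lift μ f (D.of (i + 1) a)) (D.lift μ f (D.of (j + 1) b))) (a b : D.Alg) :
    D.lift μ f (D.mulMap a b + c a b) = μ (D.lift μ f a) (D.lift μ f b) := by
  have : (D.mulMap + c).compr₂ (D.lift μ f) = μ.compl₁₂ (D.lift μ f) (D.lift μ f) := by
    refine D.hom_ext₂ fun i j a b => ?_
    change D.lift μ f (D.mulMap (D.of i a) (D.of j b) + c (D.of i a) (D.of j b))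
      = μ (D.lift μ f (D.of i a)) (D.lift μ f (D.of j b))
    match i, j, a, b with
    | 0, j, a, b =>
      rw [hc _ _ _ _ (Or.inl rfl), add_zero, of_zero_mul, lift_of_zero, map_smul, map_smul,
        LinearMap.smul_apply, hl]
    | i + 1, 0, a, b =>
      rw [hc _ _ _ _ (Or.inr (Or.inl rfl)), add_zero, mul_of_zero, lift_of_zero, map_smul,
        map_smul, hr]
    | i + 1, j + 1, a, b =>
      by_cases h : i + 1 + (j + 1) ≤ D.d
      · exact hlow i j h a b
      -- Above `d` the correction is zero, and the lift is multiplicative by construction.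
      · rw [hc _ _ _ _ (Or.inr (Or.inr (not_le.1 h))), add_zero, lift_mul_high D μ f h]
  exact LinearMap.congr_fun₂ this a b

/-- Linear maps which are multiplicative above the degree `d` are determined by their values in
degrees `≤ d`. -/
theorem hom_ext_of_mul {φ φ' : D.Alg →ₗ[K] P}
    (hlow : ∀ n ≤ D.d, ∀ x, φ (D.of n x) = φ' (D.of n x))
    (hφ : ∀ i j a b, D.d < i + j →
      φ (D.mulMap (D.of i a) (D.of j b)) = μ (φ (D.of i a)) (φ (D.of j b)))
    (hφ' : ∀ i j a b, D.d < i + j →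
      φ' (D.mulMap (D.of i a) (D.of j b)) = μ (φ' (D.of i a)) (φ' (D.of j b))) : φ = φ' := by
  refine D.hom_ext fun n => ?_
  induction n using Nat.strong_induction_on with
  | _ n ih =>
    by_cases h : n ≤ D.d
    · exact hlow n h
    · intro x
      refine D.degree_le_of_high h (LinearMap.eqLocus φ φ') (fun i j a b hij => ?_) ⟨x, rfl⟩
      subst hij
      rw [LinearMap.mem_eqLocus, hφ _ _ _ _ (not_le.1 h), hφ' _ _ _ _ (not_le.1 h),
        ih _ (by omega), ih _ (by omega)]

end TruncData

/-! ### Algebras satisfying the relations, and linear maps from `V(M)` given in degrees up to 3. -/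

namespace AkivisSuperalgebra

variable {K : Type u} {M : Type v} [Field K] [AddCommGroup M] [Module K M]
  (X : AkivisSuperalgebra K M)

/-- A nonassociative algebra `P` with unit element `e` and a linear map from `M` to `P` satisfying
the relations of the universal enveloping superalgebra. -/
structure IsRepresentation {P : Type*} [AddCommGroup P] [Module K P] (μ : P →ₗ[K] P →ₗ[K] P)
    (e : P) (ι : M →ₗ[K] P) : Prop where
  one_mul : ∀ v, μ e v = v
  mul_one : ∀ v, μ v e = v
  comm : ∀ α β x y, x ∈ X.gr α → y ∈ X.gr β →
    μ (ι x) (ι y) = sgn K (α * β) • μ (ι y) (ι x) + ι (X.bracket x y)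
  assoc : ∀ x y z, μ (μ (ι x) (ι y)) (ι z) = μ (ι x) (μ (ι y) (ι z)) + ι (X.A x y z)

section SymLift

variable {P : Type*} [AddCommGroup P] [Module K P] {gr : ZMod 2 → Submodule K M}
  (e : P) (f₁ f₂ f₃ : SuperSym gr →ₗ[K] P)

/-- The linear map on the components of degree `≤ 3` of `V(M)` given by its restrictions. -/
def symMaps : ∀ n, (symData gr).comp n →ₗ[K] P
  | 0 => (LinearMap.toSpanSingleton K P e).comp
      (ULift.moduleEquiv : ULift.{v} K ≃ₗ[K] K).toLinearMap
  | 1 => f₁.comp (SuperSym.degree gr 1).subtype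
  | 2 => f₂.comp (SuperSym.degree gr 2).subtype
  | 3 => f₃.comp (SuperSym.degree gr 3).subtype
  -- A default value: `levelLift` never reads components above degree 3.
  | _ + 4 => 0

theorem symMaps_zero : symMaps e f₁ f₂ f₃ 0 ((symData gr).unitEquiv.symm 1) = e := by
  change (1 : K) • e = e
  rw [one_smul]

variable (μ : P →ₗ[K] P →ₗ[K] P)

theorem lift_symMaps_one :
    (symData gr).lift μ (symMaps e f₁ f₂ f₃) (symData gr).one = e := by
  rw [TruncData.lift_one, symMaps_zero]

theorem lift_symMaps_ι (x : M) :
    (symData gr).lift μ (symMaps e f₁ f₂ f₃) (V.ι gr x) = f₁ (SuperSym.ι gr x) := by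
  exact (symData gr).lift_of_lowEquiv_symm μ (symMaps e f₁ f₂ f₃) (n := 1) (by decide : 1 ≤ 3) _

theorem lift_symMaps_ι_mul_ι (x y : M) :
    (symData gr).lift μ (symMaps e f₁ f₂ f₃) ((symData gr).mulMap (V.ι gr x) (V.ι gr y))
      = f₂ (SuperSym.ι gr x * SuperSym.ι gr y) := by
  rw [V.ι_mul_ι]
  exact (symData gr).lift_of_lowEquiv_symm μ (symMaps e f₁ f₂ f₃) (n := 2) (by decide : 2 ≤ 3) _

theorem lift_symMaps_ι_mul_ι_mul_ι (x y z : M) :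
    (symData gr).lift μ (symMaps e f₁ f₂ f₃)
        ((symData gr).mulMap ((symData gr).mulMap (V.ι gr x) (V.ι gr y)) (V.ι gr z))
      = f₃ (SuperSym.ι gr x * SuperSym.ι gr y * SuperSym.ι gr z) := by
  rw [V.ι_mul_ι_mul_ι]
  exact (symData gr).lift_of_lowEquiv_symm μ (symMaps e f₁ f₂ f₃) (n := 3) (by decide : 3 ≤ 3) _

/-- The maps with different restrictions in degree `3` agree on the elements of degree `≤ 2`. -/
theorem lift_symMaps_eq_of_mem_filtration (f₃' : SuperSym gr →ₗ[K] P) {v : V gr}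
    (hv : v ∈ (symData gr).filtration 2) :
    (symData gr).lift μ (symMaps e f₁ f₂ f₃) v = (symData gr).lift μ (symMaps e f₁ f₂ f₃') v := by
  have : (symData gr).filtration 2 ≤ LinearMap.eqLocus
      ((symData gr).lift μ (symMaps e f₁ f₂ f₃)) ((symData gr).lift μ (symMaps e f₁ f₂ f₃')) := by
    refine iSup_le fun i => ?_
    rintro _ ⟨x, rfl⟩
    rw [LinearMap.mem_eqLocus]
    obtain ⟨i, hi⟩ := i
    have h3 : i ≤ (symData gr).d := by change i ≤ 3; omega
    rw [TruncData.lift_of_low _ _ _ h3, TruncData.lift_of_low _ _ _ h3]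
    match i, hi with
    | 0, _ => rfl
    | 1, _ => rfl
    | 2, _ => rfl
  exact this hv

variable {e f₁ f₂ f₃ μ}

theorem lift_symMaps_mem_degree (Q : ℕ → Submodule K P)
    (hμ : ∀ i j a b, a ∈ Q i → b ∈ Q j → μ a b ∈ Q (i + j)) (h0 : e ∈ Q 0)
    (h1 : ∀ x, f₁ (SuperSym.ι gr x) ∈ Q 1)
    (h2 : ∀ x y, f₂ (SuperSym.ι gr x * SuperSym.ι gr y) ∈ Q 2)
    (h3 : ∀ x y z, f₃ (SuperSym.ι gr x * SuperSym.ι gr y * SuperSym.ι gr z) ∈ Q 3)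
    (n : ℕ) (x : (symData gr).level n) :
    (symData gr).lift μ (symMaps e f₁ f₂ f₃) ((symData gr).of n x) ∈ Q n := by
  refine (symData gr).lift_mem_degree μ _ Q hμ (fun n hn x => ?_) n x
  match n, hn, x with
  | 0, _, x => exact (Q 0).smul_mem _ h0
  | 1, _, x => exact SuperSym.degree_one_le (Q := (Q 1).comap f₁) h1 x.2
  | 2, _, x => exact SuperSym.degree_two_le (Q := (Q 2).comap f₂) h2 x.2
  | 3, _, x => exact SuperSym.degree_three_le (Q := (Q 3).comap f₃) h3 x.2

theorem lift_symMaps_mem_parity (Q : ZMod 2 → Submodule K P)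
    (hμ : ∀ α β a b, a ∈ Q α → b ∈ Q β → μ a b ∈ Q (α + β)) (h0 : e ∈ Q 0)
    (h1 : ∀ α, ∀ x ∈ gr α, f₁ (SuperSym.ι gr x) ∈ Q α)
    (h2 : ∀ α β, ∀ x ∈ gr α, ∀ y ∈ gr β, f₂ (SuperSym.ι gr x * SuperSym.ι gr y) ∈ Q (α + β))
    (h3 : ∀ α β γ, ∀ x ∈ gr α, ∀ y ∈ gr β, ∀ z ∈ gr γ,
      f₃ (SuperSym.ι gr x * SuperSym.ι gr y * SuperSym.ι gr z) ∈ Q (α + β + γ)) (γ : ZMod 2) :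
    (symData gr).parity γ ≤ (Q γ).comap ((symData gr).lift μ (symMaps e f₁ f₂ f₃)) := by
  refine (symData gr).lift_mem_parity μ _ Q hμ (fun n hn γ x hx => ?_) γ
  match n, hn, x, hx with
  | 0, _, x, hx =>
    by_cases hγ : γ = 0
    · subst hγ
      exact (Q 0).smul_mem _ h0
    · have hx' : x ∈ (if γ = 0 then ⊤ else ⊥ : Submodule K ((symData gr).comp 0)) := hx
      rw [if_neg hγ, Submodule.mem_bot] at hx'
      rw [hx', map_zero]
      exact zero_mem _
  | 1, _, x, hx => exact SuperSym.degreePar_one_le (γ := γ) (Q := (Q γ).comap f₁) (h1 γ) hx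
  | 2, _, x, hx =>
    exact SuperSym.degreePar_two_le (γ := γ) (Q := (Q γ).comap f₂)
      (fun α β x y hx hy h => h ▸ h2 α β x hx y hy) hx
  | 3, _, x, hx =>
    exact SuperSym.degreePar_three_le (γ := γ) (Q := (Q γ).comap f₃)
      (fun α β δ x y z hx hy hz h => h ▸ h3 α β δ x hx y hy z hz) hx

end SymLift

end AkivisSuperalgebra

/-! ### The universal property of the deformed algebra. -/

namespace AkivisSuperalgebra

variable {K : Type u} {M : Type v} [Field K] [AddCommGroup M] [Module K M]
  {X : AkivisSuperalgebra K M}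

section

variable {c : V X.gr →ₗ[K] V X.gr →ₗ[K] V X.gr}

theorem IsCorrection.mul_ι_mem (hc : X.IsCorrection c) (x y z : M) :
    c ((symData X.gr).mulMap (V.ι X.gr x) (V.ι X.gr y)) (V.ι X.gr z)
      ∈ (symData X.gr).filtration 2 := by
  rw [V.ι_mul_ι]
  exact hc.mem_filtration 2 1 2 _ _ rfl

theorem IsCorrection.ι_mul_mem (hc : X.IsCorrection c) (x y z : M) :
    c (V.ι X.gr x) ((symData X.gr).mulMap (V.ι X.gr y) (V.ι X.gr z))
      ∈ (symData X.gr).filtration 2 := by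
  rw [V.ι_mul_ι]
  exact hc.mem_filtration 1 2 2 _ _ rfl

variable {P : Type*} [AddCommGroup P] [Module K P]

/-- Two bilinear maps which agree on the elements `(x, y)`, `(x y, z)`, `(x, y z)` for `x`, `y`, `z`
in `M` agree on the components of positive degrees `i`, `j` with `i + j ≤ 3`. -/
theorem bilin_ext_low {L R : V X.gr →ₗ[K] V X.gr →ₗ[K] P}
    (h₁ : ∀ x y, L (V.ι X.gr x) (V.ι X.gr y) = R (V.ι X.gr x) (V.ι X.gr y))
    (h₂ : ∀ x y z, L ((symData X.gr).mulMap (V.ι X.gr x) (V.ι X.gr y)) (V.ι X.gr z)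
      = R ((symData X.gr).mulMap (V.ι X.gr x) (V.ι X.gr y)) (V.ι X.gr z))
    (h₃ : ∀ x y z, L (V.ι X.gr x) ((symData X.gr).mulMap (V.ι X.gr y) (V.ι X.gr z))
      = R (V.ι X.gr x) ((symData X.gr).mulMap (V.ι X.gr y) (V.ι X.gr z)))
    (i j : ℕ) (hij : i + 1 + (j + 1) ≤ 3) (a : (symData X.gr).level (i + 1))
    (b : (symData X.gr).level (j + 1)) :
    L ((symData X.gr).of (i + 1) a) ((symData X.gr).of (j + 1) b)
      = R ((symData X.gr).of (i + 1) a) ((symData X.gr).of (j + 1) b) := by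
  have key : (i = 0 ∧ j = 0) ∨ (i = 1 ∧ j = 0) ∨ (i = 0 ∧ j = 1) := by omega
  rcases key with ⟨rfl, rfl⟩ | ⟨rfl, rfl⟩ | ⟨rfl, rfl⟩
  · exact V.degree_one_le (Q := LinearMap.eqLocus (L.flip _) (R.flip _)) (fun x =>
      V.degree_one_le (Q := LinearMap.eqLocus (L _) (R _)) (fun y => h₁ x y) ⟨b, rfl⟩) ⟨a, rfl⟩
  · exact V.degree_two_le (Q := LinearMap.eqLocus (L.flip _) (R.flip _)) (fun x y =>
      V.degree_one_le (Q := LinearMap.eqLocus (L _) (R _)) (fun z => h₂ x y z) ⟨b, rfl⟩) ⟨a, rfl⟩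
  · exact V.degree_one_le (Q := LinearMap.eqLocus (L.flip _) (R.flip _)) (fun x =>
      V.degree_two_le (Q := LinearMap.eqLocus (L _) (R _)) (fun y z => h₃ x y z) ⟨b, rfl⟩) ⟨a, rfl⟩

/-- The deformation of `V(M)` maps to every algebra satisfying the relations of the universal
enveloping superalgebra. -/
theorem IsCorrection.exists_hom (h2 : (2 : K) ≠ 0) (hc : X.IsCorrection c)
    {μ : P →ₗ[K] P →ₗ[K] P} {e : P} {ι : M →ₗ[K] P} (hP : X.IsRepresentation μ e ι) :
    ∃ ψ : V X.gr →ₗ[K] P, ψ (symData X.gr).one = e ∧ (∀ x, ψ (V.ι X.gr x) = ι x) ∧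
      (∀ a b, ψ ((symData X.gr).mulMap a b + c a b) = μ (ψ a) (ψ b)) ∧
      (∀ Q : ℕ → Submodule K P, (Monotone Q ∨ (c = 0 ∧ X.bracket = 0)) →
        (∀ i j a b, a ∈ Q i → b ∈ Q j → μ a b ∈ Q (i + j)) → e ∈ Q 0 → (∀ x, ι x ∈ Q 1) →
        ∀ n x, ψ ((symData X.gr).of n x) ∈ Q n) ∧
      (∀ Q : ZMod 2 → Submodule K P,
        (∀ α β a b, a ∈ Q α → b ∈ Q β → μ a b ∈ Q (α + β)) → e ∈ Q 0 →
        (∀ α, ∀ x ∈ X.gr α, ι x ∈ Q α) → ∀ γ, (symData X.gr).parity γ ≤ (Q γ).comap ψ) := by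
  have h22 : (2 : K)⁻¹ + (2 : K)⁻¹ = 1 := by rw [← two_mul, mul_inv_cancel₀ h2]
  obtain ⟨g₁, hg₁⟩ := SuperSym.exists_lift_one X.gr
  -- The value on `x y` forced by multiplicativity, as the deformed product of `x` and `y` is `x y +
  -- [x, y] / 2`.
  let f : M →ₗ[K] M →ₗ[K] P := μ.compl₁₂ ι ι - (2 : K)⁻¹ • X.bracket.compr₂ ι
  have hf : ∀ x y, f x y = μ (ι x) (ι y) - (2 : K)⁻¹ • ι (X.bracket x y) := fun _ _ => rfl
  have hfsym : ∀ α β x y, x ∈ X.gr α → y ∈ X.gr β → f x y = sgn K (α * β) • f y x := by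
    intro α β x y hx hy
    rw [hf, hf, hP.comm α β x y hx hy, smul_sub, smul_comm, ← map_smul ι (sgn K _),
      ← neg_neg (sgn K (α * β) • X.bracket y x), ← X.bracket_anticomm α β x y hx hy, map_neg]
    linear_combination (norm := module) (-h22) • ι (X.bracket x y)
  obtain ⟨f₂, hf₂⟩ := SuperSym.exists_lift_two (gr := X.gr) f hfsym
  -- A provisional map, zero in degree 3. The values in degree 3 involve the images of corrections,
  -- which have degree at most 2, where `ψ'` is already final.
  let ψ' := (symData X.gr).lift μ (symMaps e (ι.comp g₁) f₂ 0)
  have hψ'ι : ∀ x, ψ' (V.ι X.gr x) = ι x := fun x =>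
    (lift_symMaps_ι _ _ _ _ _ _).trans (congrArg ι (hg₁ x))
  have hψ'2 : ∀ x y, ψ' ((symData X.gr).mulMap (V.ι X.gr x) (V.ι X.gr y)) = f x y := fun x y =>
    (lift_symMaps_ι_mul_ι _ _ _ _ _ _ _).trans (hf₂ x y)
  -- The value on `x y z` forced by the product `(x y) z`.
  let G : M →ₗ[K] M →ₗ[K] M →ₗ[K] P := f.compr₂ (μ.compl₂ ι) -
    ((symData X.gr).mulMap.compl₁₂ (V.ι X.gr) (V.ι X.gr)).compr₂
      ((c.compl₂ (V.ι X.gr)).compr₂ ψ')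
  have hG : ∀ x y z, G x y z = μ (f x y) (ι z)
      - ψ' (c ((symData X.gr).mulMap (V.ι X.gr x) (V.ι X.gr y)) (V.ι X.gr z)) :=
    fun _ _ _ => rfl
  -- The product `x (y z)` forces the same value: the defect equation for `c` matches the associator
  -- relation in `P`.
  have hG' : ∀ x y z, G x y z = μ (ι x) (f y z)
      - ψ' (c (V.ι X.gr x) ((symData X.gr).mulMap (V.ι X.gr y) (V.ι X.gr z))) := by
    intro x y z
    have h := congrArg ψ' (hc.sub_eq x y z)
    rw [defect_apply] at h
    simp only [map_add, map_sub, map_smul, hψ'ι, LinearMap.compl₁₂_apply, hψ'2] at h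
    rw [hG, sub_eq_sub_iff_add_eq_add, ← sub_eq_zero]
    rw [← sub_eq_zero] at h
    rw [← neg_eq_zero, ← h]
    simp only [hf, map_sub, map_smul, LinearMap.sub_apply, LinearMap.smul_apply, hP.assoc]
    module
  -- `hG` shows symmetry in the first two arguments and `hG'` in the last two.
  obtain ⟨f₃, hf₃⟩ := SuperSym.exists_lift_three (gr := X.gr) G
    (fun α β x y z hx hy => by
      rw [hG, hG, hfsym α β x y hx hy, V.ι_supercomm hx hy]
      simp only [map_smul, LinearMap.smul_apply, smul_sub])
    (fun β γ x y z hy hz => by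
      rw [hG', hG', hfsym β γ y z hy hz, V.ι_supercomm hy hz]
      simp only [map_smul, smul_sub])
  let ψ := (symData X.gr).lift μ (symMaps e (ι.comp g₁) f₂ f₃)
  have hψψ' : ∀ v ∈ (symData X.gr).filtration 2, ψ v = ψ' v := fun v hv =>
    lift_symMaps_eq_of_mem_filtration _ _ _ _ _ _ hv
  have hψι : ∀ x, ψ (V.ι X.gr x) = ι x := fun x =>
    (lift_symMaps_ι _ _ _ _ _ _).trans (congrArg ι (hg₁ x))
  have hψ2 : ∀ x y, ψ ((symData X.gr).mulMap (V.ι X.gr x) (V.ι X.gr y)) = f x y := fun x y =>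
    (lift_symMaps_ι_mul_ι _ _ _ _ _ _ _).trans (hf₂ x y)
  have hψ3 : ∀ x y z, ψ ((symData X.gr).mulMap
      ((symData X.gr).mulMap (V.ι X.gr x) (V.ι X.gr y)) (V.ι X.gr z)) = G x y z := fun x y z =>
    (lift_symMaps_ι_mul_ι_mul_ι _ _ _ _ _ _ _ _).trans (hf₃ x y z)
  have hunit : symMaps e (ι.comp g₁) f₂ f₃ 0 ((symData X.gr).unitEquiv.symm 1) = e :=
    symMaps_zero _ _ _ _
  refine ⟨ψ, lift_symMaps_one _ _ _ _ _, hψι, fun a b => ?_, fun Q hQ hμ he hι => ?_,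
    fun Q hμ he hι => ?_⟩
  · refine (symData X.gr).lift_mul_add μ _ (by rw [hunit]; exact hP.one_mul)
      (by rw [hunit]; exact hP.mul_one) c hc.eq_zero (fun i j hij a b => ?_) a b
    refine bilin_ext_low (L := ((symData X.gr).mulMap + c).compr₂ ψ) (R := μ.compl₁₂ ψ ψ)
      (fun x y => ?_) (fun x y z => ?_) (fun x y z => ?_) i j hij a b
    · change ψ (_ + c _ _) = μ (ψ _) (ψ _)
      rw [map_add, hψ2, hc.ι_ι, map_smul, hψι, hψι, hψι, hf]
      abel
    · change ψ (_ + c _ _) = μ (ψ _) (ψ _)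
      rw [map_add, hψ3, hψψ' _ (hc.mul_ι_mem x y z), hψι, hψ2, hG]
      abel
    · change ψ (_ + c _ _) = μ (ψ _) (ψ _)
      rw [map_add, ← V.ι_assoc, hψ3, hψψ' _ (hc.ι_mul_mem x y z), hψι, hψ2, hG']
      abel
  -- The terms of lower degree are absorbed when `Q` is monotone, and vanish when both the bracket
  -- and the correction do.
  · have h2Q : ∀ x y, f₂ (SuperSym.ι X.gr x * SuperSym.ι X.gr y) ∈ Q 2 := by
      intro x y
      rw [hf₂, hf]
      refine sub_mem (hμ 1 1 _ _ (hι x) (hι y)) (Submodule.smul_mem _ _ ?_)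
      rcases hQ with hQ | ⟨-, hb⟩
      · exact hQ (by decide) (hι _)
      · simp [hb]
    have h1Q : ∀ x, (ι.comp g₁) (SuperSym.ι X.gr x) ∈ Q 1 := fun x => by
      rw [LinearMap.comp_apply, hg₁]; exact hι x
    refine lift_symMaps_mem_degree Q hμ he h1Q h2Q fun x y z => ?_
    rw [hf₃, hG, ← hf₂]
    refine sub_mem (hμ 2 1 _ _ (h2Q x y) (hι z)) ?_
    rcases hQ with hQ | ⟨hc0, -⟩
    · have : (symData X.gr).filtration 2 ≤ (Q 3).comap ψ' := by
        refine iSup_le fun i => ?_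
        rintro _ ⟨v, rfl⟩
        refine hQ (by omega : (i : ℕ) ≤ 3) ?_
        exact lift_symMaps_mem_degree Q hμ he h1Q h2Q (fun x y z => zero_mem _) i v
      exact this (hc.mul_ι_mem x y z)
    · simp [hc0]
  · have h2Q : ∀ α β, ∀ x ∈ X.gr α, ∀ y ∈ X.gr β,
        f₂ (SuperSym.ι X.gr x * SuperSym.ι X.gr y) ∈ Q (α + β) := by
      intro α β x hx y hy
      rw [hf₂, hf]
      exact sub_mem (hμ _ _ _ _ (hι _ x hx) (hι _ y hy))
        (Submodule.smul_mem _ _ (hι _ _ (X.bracket_mem _ _ _ _ hx hy)))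
    have h1Q : ∀ α, ∀ x ∈ X.gr α, (ι.comp g₁) (SuperSym.ι X.gr x) ∈ Q α := fun α x hx => by
      rw [LinearMap.comp_apply, hg₁]; exact hι α x hx
    refine lift_symMaps_mem_parity Q hμ he h1Q h2Q fun α β γ x hx y hy z hz => ?_
    rw [hf₃, hG, ← hf₂]
    refine sub_mem (hμ _ _ _ _ (h2Q _ _ x hx y hy) (hι _ z hz)) ?_
    have := lift_symMaps_mem_parity (f₃ := 0) Q hμ he h1Q h2Q
      (fun _ _ _ _ _ _ _ _ _ => zero_mem _) (α + β + γ)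
    exact this (hc.mem_parity _ _ _ _ (symData_isSuper.mul_mem_parity (V.ι_mem_parity hx)
      (V.ι_mem_parity hy)) (V.ι_mem_parity hz))

/-- The deformation of `V(M)` satisfies the relations of the universal enveloping superalgebra. -/
theorem IsCorrection.isRepresentation (h2 : (2 : K) ≠ 0) (hc : X.IsCorrection c) :
    X.IsRepresentation ((symData X.gr).mulMap + c) (symData X.gr).one (V.ι X.gr) where
  one_mul v := by
    have : c (symData X.gr).one = 0 := (symData X.gr).hom_ext fun j b =>
      hc.eq_zero 0 j _ b (Or.inl rfl)
    change (symData X.gr).mulMap _ v + c _ v = v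
    rw [this, TruncData.one_mul, LinearMap.zero_apply, add_zero]
  mul_one v := by
    have : c.flip (symData X.gr).one = 0 := (symData X.gr).hom_ext fun j b =>
      hc.eq_zero j 0 b _ (Or.inr (Or.inl rfl))
    change (symData X.gr).mulMap v _ + c.flip _ v = v
    rw [this, TruncData.mul_one, LinearMap.zero_apply, add_zero]
  comm α β x y hx hy := by
    have h22 : (2 : K)⁻¹ + (2 : K)⁻¹ = 1 := by rw [← two_mul, mul_inv_cancel₀ h2]
    have hb := congrArg (V.ι X.gr) (X.bracket_anticomm α β x y hx hy)
    rw [map_neg, map_smul] at hb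
    change (symData X.gr).mulMap _ _ + c _ _
      = sgn K (α * β) • ((symData X.gr).mulMap _ _ + c _ _) + _
    rw [hc.ι_ι, hc.ι_ι, V.ι_supercomm hx hy, smul_add, smul_comm (sgn K (α * β)) (2 : K)⁻¹,
      ← neg_neg (sgn K (α * β) • V.ι X.gr (X.bracket y x)), ← hb]
    linear_combination (norm := module) h22 • V.ι X.gr (X.bracket x y)
  assoc x y z := by
    have h := hc.sub_eq x y z
    rw [defect_apply, sub_eq_iff_eq_add] at h
    change (symData X.gr).mulMap ((symData X.gr).mulMap _ _ + c _ _) _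
        + c ((symData X.gr).mulMap _ _ + c _ _) _
      = (symData X.gr).mulMap _ ((symData X.gr).mulMap _ _ + c _ _)
        + c _ ((symData X.gr).mulMap _ _ + c _ _) + _
    -- After expansion, what remains is the identity that dictated `defect`.
    simp only [map_add, LinearMap.add_apply, h, hc.ι_ι, map_smul, LinearMap.smul_apply, V.ι_assoc,
      LinearMap.compl₁₂_apply]
    module

end

end AkivisSuperalgebra

theorem TruncData.mul_mem_degree {K : Type u} [Field K] (D : TruncData.{u, w} K) {i j : ℕ}
    {a b : D.Alg} (ha : a ∈ D.degree i) (hb : b ∈ D.degree j) :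
    D.mulMap a b ∈ D.degree (i + j) := by
  obtain ⟨a, rfl⟩ := ha
  obtain ⟨b, rfl⟩ := hb
  rw [mulMap_of_of]
  exact D.mulPiece_mem i j a b

/-! ### The universal property of the nonassociative tensor algebra. -/

section Tensor

variable {K : Type u} {M : Type v} [Field K] [AddCommGroup M] [Module K M]
  {gr : ZMod 2 → Submodule K M}

theorem tensorData_isSuper : (tensorData gr).IsSuper where
  par_zero _ := rfl
  mul_mem _ _ _ _ _ _ _ _ _ := zero_mem _

namespace NATensor

theorem ι_mem_parity {α : ZMod 2} {x : M} (hx : x ∈ gr α) :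
    NATensor.ι gr x ∈ (tensorData gr).parity α := by
  refine (tensorData gr).of_mem_parity ?_
  rw [(tensorData gr).of_levelPar_low (n := 1) le_rfl]
  refine Submodule.mem_comap.2 ?_
  have := ((tensorData gr).lowEquiv (n := 1) le_rfl).apply_symm_apply (ULift.up x)
  exact this.symm ▸ hx

theorem of_one_eq (x : (tensorData gr).level 1) : ∃ m, (tensorData gr).of 1 x = NATensor.ι gr m := by
  refine ⟨(ULift.moduleEquiv : ULift.{u} M ≃ₗ[K] M)
    ((tensorData gr).lowEquiv (n := 1) le_rfl x), congrArg ((tensorData gr).of 1) ?_⟩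
  exact (((tensorData gr).lowEquiv (n := 1) le_rfl).symm_apply_apply x).symm

variable {P : Type*} [AddCommGroup P] [Module K P] (μ : P →ₗ[K] P →ₗ[K] P) (e : P)
  (φ : M →ₗ[K] P)

/-- The linear map on the components of degree `≤ 1` of `T̃(M)` given by its restrictions. -/
def maps (gr : ZMod 2 → Submodule K M) : ∀ n, (tensorData gr).comp n →ₗ[K] P
  | 0 => (LinearMap.toSpanSingleton K P e).comp
      (ULift.moduleEquiv : ULift.{v} K ≃ₗ[K] K).toLinearMap
  | _ + 1 => φ.comp (ULift.moduleEquiv : ULift.{u} M ≃ₗ[K] M).toLinearMap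

theorem maps_zero : maps e φ gr 0 ((tensorData gr).unitEquiv.symm 1) = e := by
  change (1 : K) • e = e
  rw [one_smul]

/-- The universal property of the nonassociative tensor algebra. -/
theorem exists_hom (gr : ZMod 2 → Submodule K M) (hl : ∀ v, μ e v = v) (hr : ∀ v, μ v e = v) :
    ∃ θ : NATensor gr →ₗ[K] P, θ (tensorData gr).one = e ∧ (∀ x, θ (NATensor.ι gr x) = φ x) ∧
      (∀ a b, θ ((tensorData gr).mulMap a b) = μ (θ a) (θ b)) ∧
      (∀ Q : ℕ → Submodule K P, (∀ i j a b, a ∈ Q i → b ∈ Q j → μ a b ∈ Q (i + j)) →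
        e ∈ Q 0 → (∀ x, φ x ∈ Q 1) → ∀ n, (tensorData gr).degree n ≤ (Q n).comap θ) ∧
      (∀ Q : ZMod 2 → Submodule K P,
        (∀ α β a b, a ∈ Q α → b ∈ Q β → μ a b ∈ Q (α + β)) → e ∈ Q 0 →
        (∀ α, ∀ x ∈ gr α, φ x ∈ Q α) → ∀ γ, (tensorData gr).parity γ ≤ (Q γ).comap θ) := by
  have hunit := maps_zero (gr := gr) e φ
  refine ⟨(tensorData gr).lift μ (maps e φ gr), ?_, fun x => ?_, fun a b => ?_,
    fun Q hμ he hφ n => ?_, fun Q hμ he hφ γ => ?_⟩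
  · rw [TruncData.lift_one, hunit]
  · exact (tensorData gr).lift_of_lowEquiv_symm μ (maps e φ gr) (n := 1) le_rfl _
  -- There is no correction, and since `d = 1` no two positive degrees have sum at most `d`, so the
  -- condition in low degrees is void.
  · have := (tensorData gr).lift_mul_add μ (maps e φ gr) (by rw [hunit]; exact hl)
      (by rw [hunit]; exact hr) 0 (fun _ _ _ _ _ => rfl)
      (fun i j h => absurd h (by change ¬ i + 1 + (j + 1) ≤ 1; omega)) a b
    rwa [LinearMap.zero_apply, LinearMap.zero_apply, add_zero] at this
  · rintro _ ⟨x, rfl⟩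
    refine (tensorData gr).lift_mem_degree μ _ Q hμ (fun n hn x => ?_) n x
    match n, hn, x with
    | 0, _, x => exact (Q 0).smul_mem _ he
    | 1, _, x => exact hφ _
  · refine (tensorData gr).lift_mem_parity μ _ Q hμ (fun n hn γ x hx => ?_) γ
    match n, hn, x, hx with
    | 0, _, x, hx =>
      by_cases hγ : γ = 0
      · subst hγ
        exact (Q 0).smul_mem _ he
      · have hx' : x ∈ (if γ = 0 then ⊤ else ⊥ : Submodule K ((tensorData gr).comp 0)) := hx
        rw [if_neg hγ, Submodule.mem_bot] at hx'
        rw [hx', map_zero]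
        exact zero_mem _
    | 1, _, x, hx => exact hφ γ _ hx

theorem hom_ext {θ θ' : NATensor gr →ₗ[K] P}
    (h0 : θ (tensorData gr).one = θ' (tensorData gr).one)
    (h1 : ∀ x, θ (NATensor.ι gr x) = θ' (NATensor.ι gr x))
    (h : ∀ a b, θ ((tensorData gr).mulMap a b) = μ (θ a) (θ b))
    (h' : ∀ a b, θ' ((tensorData gr).mulMap a b) = μ (θ' a) (θ' b)) : θ = θ' := by
  refine (tensorData gr).hom_ext_of_mul μ (fun n hn x => ?_) (fun _ _ _ _ _ => h _ _)
    (fun _ _ _ _ _ => h' _ _)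
  match n, hn, x with
  | 0, _, x => rw [TruncData.of_zero_eq, map_smul, map_smul, h0]
  | 1, _, x =>
    obtain ⟨m, hm⟩ := of_one_eq x
    rw [hm, h1]

end NATensor

end Tensor

/-! ### The universal property of `Ũ(M)` and its identification with the deformed algebra. -/

namespace AkivisSuperalgebra

variable {K : Type u} {M : Type v} [Field K] [AddCommGroup M] [Module K M]
  (X : AkivisSuperalgebra K M)

theorem relations_subset_ideal : X.relations ⊆ X.ideal := fun _ ht =>
  (Submodule.mem_sInf).2 fun _ hJ => hJ.1 ht

namespace Env

theorem mulMap_mk (a b : NATensor X.gr) : mulMap X (X.ideal.mkQ a) (X.ideal.mkQ b)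
    = X.ideal.mkQ ((tensorData X.gr).mulMap a b) := quotBilin_mk _ _ _ _ _ _ _

theorem isRepresentation : X.IsRepresentation (mulMap X) (one X) (ι X) where
  one_mul v := by
    obtain ⟨v, rfl⟩ := X.ideal.mkQ_surjective v
    rw [one, mulMap_mk, TruncData.one_mul]
  mul_one v := by
    obtain ⟨v, rfl⟩ := X.ideal.mkQ_surjective v
    rw [one, mulMap_mk, TruncData.mul_one]
  comm α β x y hx hy := by
    have h := X.relations_subset_ideal (Or.inl ⟨α, β, x, y, hx, hy, rfl⟩)
    rw [SetLike.mem_coe, ← X.ideal.ker_mkQ, LinearMap.mem_ker, map_sub, map_sub, map_smul,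
      ← mulMap_mk, ← mulMap_mk, sub_sub, sub_eq_zero] at h
    exact h
  assoc := by
    let μ := mulMap X
    let ι := Env.ι X
    have key : ∀ α β γ x y z, x ∈ X.gr α → y ∈ X.gr β → z ∈ X.gr γ →
        μ (μ (ι x) (ι y)) (ι z) = μ (ι x) (μ (ι y) (ι z)) + ι (X.A x y z) := by
      intro α β γ x y z hx hy hz
      have h := X.relations_subset_ideal (Or.inr ⟨α, β, γ, x, y, z, hx, hy, hz, rfl⟩)
      rw [SetLike.mem_coe, ← X.ideal.ker_mkQ, LinearMap.mem_ker, map_sub, map_sub,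
        ← mulMap_mk, ← mulMap_mk, ← mulMap_mk, ← mulMap_mk, sub_sub, sub_eq_zero] at h
      exact h
    -- The associator relation carries no sign, so it extends additively from homogeneous elements
    -- to all of `M`, one argument at a time.
    have ind := fun (p : M → Prop) (hm : ∀ α, ∀ x ∈ X.gr α, p x) (h0 : p 0)
        (ha : ∀ x y, p x → p y → p (x + y)) (x : M) =>
      Submodule.iSup_induction X.gr (motive := p)
        (X.isInternal.submodule_iSup_eq_top.symm ▸ (Submodule.mem_top : x ∈ ⊤)) hm h0 ha
    intro x y z
    change μ (μ (ι x) (ι y)) (ι z) = μ (ι x) (μ (ι y) (ι z)) + ι (X.A x y z)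
    refine ind (fun x => μ (μ (ι x) (ι y)) (ι z) = μ (ι x) (μ (ι y) (ι z)) + ι (X.A x y z))
      (fun α x hx => ?_) (by simp) (fun x x' h h' => ?_) x
    · refine ind (fun y => μ (μ (ι x) (ι y)) (ι z) = μ (ι x) (μ (ι y) (ι z)) + ι (X.A x y z))
          (fun β y hy => ?_) (by simp) (fun y y' h h' => ?_) y
      · refine ind (fun z => μ (μ (ι x) (ι y)) (ι z) = μ (ι x) (μ (ι y) (ι z)) + ι (X.A x y z))
          (fun γ z hz => ?_) (by simp) (fun z z' h h' => ?_) z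
        · exact key α β γ x y z hx hy hz
        · simp only [map_add, h, h']; abel
      · simp only [map_add, LinearMap.add_apply, h, h']; abel
    · simp only [map_add, LinearMap.add_apply, h, h']; abel

theorem mul_mem_degree {i j : ℕ} {a b : X.Env} (ha : a ∈ degree X i) (hb : b ∈ degree X j) :
    mulMap X a b ∈ degree X (i + j) := by
  obtain ⟨a, ha, rfl⟩ := ha
  obtain ⟨b, hb, rfl⟩ := hb
  rw [mulMap_mk]
  exact ⟨_, (tensorData X.gr).mul_mem_degree ha hb, rfl⟩

theorem mul_mem_parity {α β : ZMod 2} {a b : X.Env} (ha : a ∈ parity X α) (hb : b ∈ parity X β) :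
    mulMap X a b ∈ parity X (α + β) := by
  obtain ⟨a, ha, rfl⟩ := ha
  obtain ⟨b, hb, rfl⟩ := hb
  rw [mulMap_mk]
  exact ⟨_, tensorData_isSuper.mul_mem_parity ha hb, rfl⟩

theorem filtration_eq_iSup (n : ℕ) : filtration X n = ⨆ i : Fin (n + 1), degree X i := by
  unfold filtration TruncData.filtration degree
  rw [Submodule.map_iSup]

theorem hom_ext {P : Type*} [AddCommGroup P] [Module K P] (μ : P →ₗ[K] P →ₗ[K] P)
    {θ θ' : X.Env →ₗ[K] P} (h0 : θ (one X) = θ' (one X)) (h1 : ∀ x, θ (ι X x) = θ' (ι X x))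
    (h : ∀ a b, θ (mulMap X a b) = μ (θ a) (θ b))
    (h' : ∀ a b, θ' (mulMap X a b) = μ (θ' a) (θ' b)) : θ = θ' := by
  refine Submodule.linearMap_qext _ (NATensor.hom_ext μ h0 h1 (fun a b => ?_) (fun a b => ?_))
  · exact (congrArg θ (mulMap_mk X a b).symm).trans (h _ _)
  · exact (congrArg θ' (mulMap_mk X a b).symm).trans (h' _ _)

end Env

variable {X}

/-- The universal property of the universal enveloping superalgebra. -/
theorem IsRepresentation.exists_hom {P : Type*} [AddCommGroup P] [Module K P]
    {μ : P →ₗ[K] P →ₗ[K] P} {e : P} {φ : M →ₗ[K] P} (hP : X.IsRepresentation μ e φ) :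
    ∃ θ : X.Env →ₗ[K] P, θ (Env.one X) = e ∧ (∀ x, θ (Env.ι X x) = φ x) ∧
      (∀ a b, θ (Env.mulMap X a b) = μ (θ a) (θ b)) ∧
      (∀ Q : ℕ → Submodule K P, (∀ i j a b, a ∈ Q i → b ∈ Q j → μ a b ∈ Q (i + j)) →
        e ∈ Q 0 → (∀ x, φ x ∈ Q 1) → ∀ n, Env.degree X n ≤ (Q n).comap θ) ∧
      (∀ Q : ZMod 2 → Submodule K P,
        (∀ α β a b, a ∈ Q α → b ∈ Q β → μ a b ∈ Q (α + β)) → e ∈ Q 0 →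
        (∀ α, ∀ x ∈ X.gr α, φ x ∈ Q α) → ∀ γ, Env.parity X γ ≤ (Q γ).comap θ) := by
  obtain ⟨θ, h0, h1, hμ, hdeg, hpar⟩ := NATensor.exists_hom μ e φ X.gr hP.one_mul hP.mul_one
  -- The kernel of a multiplicative map is a two-sided ideal, so it contains the ideal generated by
  -- the relations it kills.
  have hker : X.ideal ≤ LinearMap.ker θ := by
    refine sInf_le ⟨?_, fun a b hb => ?_⟩
    · rintro _ (⟨α, β, x, y, hx, hy, rfl⟩ | ⟨α, β, γ, x, y, z, hx, hy, hz, rfl⟩)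
      · rw [SetLike.mem_coe, LinearMap.mem_ker, map_sub, map_sub, map_smul, hμ, hμ, h1, h1, h1,
          hP.comm α β x y hx hy]
        abel
      · rw [SetLike.mem_coe, LinearMap.mem_ker, map_sub, map_sub, hμ, hμ, hμ, hμ, h1, h1, h1, h1,
          hP.assoc]
        abel
    · rw [LinearMap.mem_ker] at hb
      rw [LinearMap.mem_ker, LinearMap.mem_ker, hμ, hμ, hb]
      simp
  refine ⟨X.ideal.liftQ θ hker, h0, h1, fun a b => ?_, fun Q hQ he hφ n => ?_,
    fun Q hQ he hφ γ => ?_⟩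
  · obtain ⟨a, rfl⟩ := X.ideal.mkQ_surjective a
    obtain ⟨b, rfl⟩ := X.ideal.mkQ_surjective b
    rw [Env.mulMap_mk]
    exact hμ a b
  · exact Submodule.map_le_iff_le_comap.2 (hdeg Q hQ he hφ n)
  · exact Submodule.map_le_iff_le_comap.2 (hpar Q hQ he hφ γ)

variable {c : V X.gr →ₗ[K] V X.gr →ₗ[K] V X.gr}

theorem IsCorrection.mem_filtration_add (hc : X.IsCorrection c) {m n : ℕ} {a b : V X.gr}
    (ha : a ∈ (symData X.gr).filtration m) (hb : b ∈ (symData X.gr).filtration n) :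
    c a b ∈ (symData X.gr).filtration (m + n - 1) := by
  have key : Submodule.map₂ c ((symData X.gr).filtration m) ((symData X.gr).filtration n)
      ≤ (symData X.gr).filtration (m + n - 1) := by
    unfold TruncData.filtration
    rw [Submodule.map₂_iSup_left]
    refine iSup_le fun i => ?_
    rw [Submodule.map₂_iSup_right]
    refine iSup_le fun j => Submodule.map₂_le.2 ?_
    rintro _ ⟨x, rfl⟩ _ ⟨y, rfl⟩
    -- The case `i = 0` is separated because of the truncated subtraction in `m + n - 1`; there the
    -- correction vanishes.
    rcases Nat.eq_zero_or_pos (i : ℕ) with hi | hi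
    · rw [hc.eq_zero _ _ _ _ (Or.inl hi)]; exact zero_mem _
    · exact (symData X.gr).filtration_mono (by omega : (i : ℕ) + j - 1 ≤ m + n - 1)
        (hc.mem_filtration i j _ x y (by omega))
  exact key (Submodule.apply_mem_map₂ _ ha hb)

/-- Endomorphisms of the deformation of `V(M)` are determined by their values on `M`. -/
theorem IsCorrection.hom_ext (hc : X.IsCorrection c) {P : Type*} [AddCommGroup P] [Module K P]
    (μ : P →ₗ[K] P →ₗ[K] P) {φ φ' : V X.gr →ₗ[K] P}
    (h0 : φ (symData X.gr).one = φ' (symData X.gr).one)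
    (h1 : ∀ x, φ (V.ι X.gr x) = φ' (V.ι X.gr x))
    (h : ∀ a b, φ ((symData X.gr).mulMap a b + c a b) = μ (φ a) (φ b))
    (h' : ∀ a b, φ' ((symData X.gr).mulMap a b + c a b) = μ (φ' a) (φ' b)) : φ = φ' := by
  have d0 : (symData X.gr).degree 0 ≤ LinearMap.eqLocus φ φ' := by
    rintro _ ⟨x, rfl⟩
    rw [LinearMap.mem_eqLocus, TruncData.of_zero_eq, map_smul, map_smul, h0]
  have d1 : (symData X.gr).degree 1 ≤ LinearMap.eqLocus φ φ' := V.degree_one_le h1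
  -- The undeformed product is the deformed one minus a correction; agreement on the latter is known
  -- from lower degrees.
  have mem : ∀ a b, a ∈ LinearMap.eqLocus φ φ' → b ∈ LinearMap.eqLocus φ φ' →
      c a b ∈ LinearMap.eqLocus φ φ' → (symData X.gr).mulMap a b ∈ LinearMap.eqLocus φ φ' := by
    intro a b ha hb hab
    rw [← add_sub_cancel_right ((symData X.gr).mulMap a b) (c a b)]
    refine sub_mem ?_ hab
    rw [LinearMap.mem_eqLocus] at ha hb ⊢
    rw [h, h', ha, hb]
  have m2 : ∀ x y, (symData X.gr).mulMap (V.ι X.gr x) (V.ι X.gr y) ∈ LinearMap.eqLocus φ φ' := by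
    refine fun x y => mem _ _ (h1 x) (h1 y) ?_
    rw [hc.ι_ι]
    exact Submodule.smul_mem _ _ (h1 _)
  have d2 : (symData X.gr).degree 2 ≤ LinearMap.eqLocus φ φ' := V.degree_two_le m2
  have f2 : (symData X.gr).filtration 2 ≤ LinearMap.eqLocus φ φ' := by
    refine iSup_le fun i => ?_
    obtain ⟨i, hi⟩ := i
    match i, hi with
    | 0, _ => exact d0
    | 1, _ => exact d1
    | 2, _ => exact d2
  have d3 : (symData X.gr).degree 3 ≤ LinearMap.eqLocus φ φ' := V.degree_three_le fun x y z =>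
    mem _ _ (m2 x y) (h1 z) (f2 (hc.mul_ι_mem x y z))
  have high : ∀ i j a b, 3 < i + j → (symData X.gr).mulMap ((symData X.gr).of i a)
      ((symData X.gr).of j b) = (symData X.gr).mulMap ((symData X.gr).of i a)
      ((symData X.gr).of j b) + c ((symData X.gr).of i a) ((symData X.gr).of j b) :=
    fun i j a b hij => by rw [hc.eq_zero i j a b (Or.inr (Or.inr hij)), add_zero]
  refine (symData X.gr).hom_ext_of_mul μ (fun n hn x => ?_)
    (fun i j a b hij => by rw [high i j a b hij, h])
    (fun i j a b hij => by rw [high i j a b hij, h'])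
  match n, hn, x with
  | 0, _, x => exact d0 ⟨x, rfl⟩
  | 1, _, x => exact d1 ⟨x, rfl⟩
  | 2, _, x => exact d2 ⟨x, rfl⟩
  | 3, _, x => exact d3 ⟨x, rfl⟩

/-- The deformation of `V(M)` is isomorphic to the universal enveloping superalgebra. -/
theorem IsCorrection.exists_equiv (h2 : (2 : K) ≠ 0) (hc : X.IsCorrection c) :
    ∃ ψ : V X.gr ≃ₗ[K] X.Env, ψ (symData X.gr).one = Env.one X ∧
      (∀ x, ψ (V.ι X.gr x) = Env.ι X x) ∧
      (∀ a b, ψ ((symData X.gr).mulMap a b + c a b) = Env.mulMap X (ψ a) (ψ b)) ∧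
      (∀ n, ((symData X.gr).filtration n).map ψ.toLinearMap = Env.filtration X n) ∧
      (c = 0 → X.bracket = 0 →
        ∀ n, ((symData X.gr).degree n).map ψ.toLinearMap = Env.degree X n) ∧
      ∀ γ, ((symData X.gr).parity γ).map ψ.toLinearMap = Env.parity X γ := by
  obtain ⟨ψ, ψ0, ψ1, ψμ, ψdeg, ψpar⟩ := hc.exists_hom h2 (Env.isRepresentation X)
  obtain ⟨θ, θ0, θ1, θμ, θdeg, θpar⟩ := (hc.isRepresentation h2).exists_hom
  -- Both composites are multiplicative, unital and the identity on `M`, so uniqueness applies on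
  -- either side.
  have hψθ : ψ.comp θ = LinearMap.id := Env.hom_ext X (Env.mulMap X)
    (by rw [LinearMap.comp_apply, θ0, ψ0]; rfl)
    (fun x => by rw [LinearMap.comp_apply, θ1, ψ1]; rfl)
    (fun a b => by
      rw [LinearMap.comp_apply, θμ]
      exact ψμ _ _)
    (fun a b => rfl)
  have hθψ : θ.comp ψ = LinearMap.id := hc.hom_ext ((symData X.gr).mulMap + c)
    (by rw [LinearMap.comp_apply, ψ0, θ0]; rfl)
    (fun x => by rw [LinearMap.comp_apply, ψ1, θ1]; rfl)
    (fun a b => by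
      rw [LinearMap.comp_apply, ψμ]
      exact θμ _ _)
    (fun a b => rfl)
  -- For mutually inverse maps, an image is computed by one inclusion for each of them.
  have map_eq : ∀ (S : Submodule K (V X.gr)) (T : Submodule K X.Env), S ≤ T.comap ψ →
      T ≤ S.comap θ → S.map ψ = T := fun S T h h' => le_antisymm (Submodule.map_le_iff_le_comap.2 h)
    fun t ht => ⟨θ t, h' ht, LinearMap.congr_fun hψθ t⟩
  refine ⟨LinearEquiv.ofLinearMap ψ θ hψθ hθψ, ψ0, ψ1, ψμ, fun n => map_eq _ _ ?_ ?_,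
    fun hc0 hb n => map_eq _ _ ?_ ?_, fun γ => map_eq _ _ ?_ ?_⟩
  · refine iSup_le fun i => ?_
    rintro _ ⟨x, rfl⟩
    exact Env.filtration_mono X (by omega : (i : ℕ) ≤ n) (ψdeg (Env.filtration X)
      (Or.inl fun _ _ => Env.filtration_mono X) (fun i j a b => Env.mul_mem_filtration X i j a b)
      (Env.one_mem_filtration X) (Env.ι_mem_filtration X) i x)
  · rw [Env.filtration_eq_iSup]
    refine iSup_le fun i => ?_
    refine (θdeg (symData X.gr).filtration (fun i j a b ha hb => ?_)
      ((symData X.gr).degree_le_filtration le_rfl ⟨_, rfl⟩) X.ι_mem_filtration_one i).trans ?_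
    · exact add_mem ((symData X.gr).mul_mem_filtration i j a b ha hb)
        ((symData X.gr).filtration_mono (Nat.sub_le _ _) (hc.mem_filtration_add ha hb))
    · exact Submodule.comap_mono ((symData X.gr).filtration_mono (by omega))
  · rintro _ ⟨x, rfl⟩
    exact ψdeg (Env.degree X) (Or.inr ⟨hc0, hb⟩) (fun i j a b => Env.mul_mem_degree X)
      ⟨_, ⟨_, rfl⟩, rfl⟩ (fun x => ⟨_, ⟨_, rfl⟩, rfl⟩) n x
  -- Degrees are multiplicative for the deformed product here because `c = 0`.
  · refine θdeg (symData X.gr).degree (fun i j a b ha hb => ?_) ⟨_, rfl⟩ (fun x => ⟨_, rfl⟩) n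
    rw [hc0, add_zero]
    exact (symData X.gr).mul_mem_degree ha hb
  · exact ψpar (Env.parity X) (fun α β a b => Env.mul_mem_parity X)
      ⟨_, tensorData_isSuper.one_mem, rfl⟩ (fun α x hx => ⟨_, NATensor.ι_mem_parity hx, rfl⟩) γ
  · exact θpar (symData X.gr).parity (fun α β a b ha hb =>
      add_mem (symData_isSuper.mul_mem_parity ha hb) (hc.mem_parity α β a b ha hb))
      symData_isSuper.one_mem (fun α x hx => V.ι_mem_parity hx) γ

end AkivisSuperalgebra

/-! ### Passage to the associated graded algebra. -/

namespace AkivisSuperalgebra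

variable {K : Type u} {M : Type v} [Field K] [AddCommGroup M] [Module K M]
  {X : AkivisSuperalgebra K M}

theorem GrEnv.mulMap_cls (i j : ℕ) (a : Env.filtration X i) (b : Env.filtration X j) :
    GrEnv.mulMap X (GrEnv.cls X i a) (GrEnv.cls X j b)
      = GrEnv.cls X (i + j) ⟨Env.mulMap X a b, Env.mul_mem_filtration X i j a b a.2 b.2⟩ :=
  (directSumBilin_lof _ _ _ _ _).trans
    (congrArg (DirectSum.lof K ℕ X.GrPiece (i + j)) (quotBilin_mk _ _ _ _ _ _ _))

theorem GrEnv.cls_eq_cls_of_sub_mem (n : ℕ) (a b : Env.filtration X n)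
    (h : (a : X.Env) - b ∈ Env.prev X n) : GrEnv.cls X n a = GrEnv.cls X n b :=
  congrArg (DirectSum.lof K ℕ X.GrPiece n) ((Submodule.Quotient.eq _).2 h)

/-- The filtered isomorphism `ψ` identifies `Ũₙ/Ũₙ₋₁` with the quotient of elements of degree at
most `n` by those of degree below `n`, which is `Vⁿ(M)`. The correction falls into the lower step,
so only the undeformed product survives. -/
theorem IsCorrection.exists_grEquiv {c : V X.gr →ₗ[K] V X.gr →ₗ[K] V X.gr} (h2 : (2 : K) ≠ 0)
    (hc : X.IsCorrection c) :
    ∃ Φ : V X.gr ≃ₗ[K] X.GrEnv,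
      (∀ a b, Φ ((symData X.gr).mulMap a b) = GrEnv.mulMap X (Φ a) (Φ b)) ∧
      Φ (symData X.gr).one = GrEnv.one X ∧
      (∀ n : ℕ, ((symData X.gr).degree n).map Φ.toLinearMap = GrEnv.degree X n) ∧
      (∀ γ : ZMod 2, ((symData X.gr).parity γ).map Φ.toLinearMap = GrEnv.parity X γ) ∧
      ∀ m : M, Φ (V.ι X.gr m) = GrEnv.ι X m := by
  obtain ⟨ψ, ψ0, ψ1, ψμ, ψfil, -, ψpar⟩ := hc.exists_equiv h2
  let D := symData X.gr
  have mem_iff : ∀ n v, ψ v ∈ Env.filtration X n ↔ v ∈ D.filtration n := fun n v => by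
    rw [← ψfil n]
    exact ⟨fun ⟨w, hw, h⟩ => ψ.injective h ▸ hw, fun h => ⟨v, h, rfl⟩⟩
  have hmem : ∀ n x, ψ (D.of n x) ∈ Env.filtration X n := fun n x =>
    (mem_iff _ _).2 (D.degree_le_filtration le_rfl ⟨x, rfl⟩)
  let φ' : ∀ n, D.level n →ₗ[K] Env.filtration X n := fun n =>
    (ψ.toLinearMap.comp (D.of n)).codRestrict _ (hmem n)
  let φ : ∀ n, D.level n →ₗ[K] X.GrPiece n := fun n => (Submodule.mkQ _).comp (φ' n)
  have hinj : ∀ n, Function.Injective (φ n) := by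
    intro n
    rw [← LinearMap.ker_eq_bot, eq_bot_iff]
    intro x hx
    have hx' : ψ (D.of n x) ∈ Env.prev X n := (Submodule.Quotient.mk_eq_zero
      ((Env.prev X n).comap (Env.filtration X n).subtype) (x := φ' n x)).1 hx
    clear hx
    cases n with
    | zero =>
      have h : ψ (D.of 0 x) = 0 := hx'
      rw [LinearEquiv.map_eq_zero_iff] at h
      have := DirectSum.component.lof_self K (M := fun n => (D.level n : Type _)) 0 x
      rw [Submodule.mem_bot, ← this]
      exact (congrArg _ h).trans (map_zero _)
    | succ n =>
      have h := D.component_of_mem_filtration (Nat.lt_succ_self n) ((mem_iff n _).1 hx')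
      rw [DirectSum.component.lof_self] at h
      exact h
  -- The class in degree `n` depends only on the component of degree `n`. This yields surjectivity,
  -- and later the description of the parities.
  have hsurj : ∀ n (v : V X.gr) (hv : ψ v ∈ Env.filtration X n), GrEnv.cls X n ⟨ψ v, hv⟩
      = DirectSum.lof K ℕ X.GrPiece n
        (φ n (DirectSum.component K ℕ (fun n => (D.level n : Type _)) n v)) := by
    intro n v hv
    refine GrEnv.cls_eq_cls_of_sub_mem n ⟨ψ v, hv⟩ (φ' n _) ?_
    change ψ v - ψ (D.of n _) ∈ _
    rw [← map_sub]
    have hv' := (mem_iff n v).1 hv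
    clear hv
    cases n with
    | zero =>
      have : D.filtration 0 ≤ D.degree 0 := iSup_le fun i => by
        have : (i : ℕ) = 0 := by omega
        rw [this]
      obtain ⟨x, rfl⟩ := this hv'
      rw [DirectSum.component.lof_self, sub_self, map_zero]
      exact zero_mem _
    | succ n =>
      obtain ⟨b, hb, h⟩ := D.exists_of_add_of_mem_filtration hv'
      rw [sub_eq_of_eq_add' h]
      exact (mem_iff n b).2 hb
  have hlof : ∀ n, Function.Injective (DirectSum.lof K ℕ X.GrPiece n) := fun n =>
    DirectSum.of_injective n
  have hbij : ∀ n, Function.Bijective (φ n) := fun n => ⟨hinj n, fun y => by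
    obtain ⟨⟨a, ha⟩, rfl⟩ := Submodule.mkQ_surjective _ y
    obtain ⟨v, rfl⟩ := ψ.surjective a
    exact ⟨_, (hlof n (hsurj n v ha)).symm⟩⟩
  let Φ : V X.gr ≃ₗ[K] X.GrEnv :=
    DFinsupp.mapRange.linearEquiv fun n => LinearEquiv.ofBijective (φ n) (hbij n)
  have hΦ : ∀ n x, Φ (D.of n x) = GrEnv.cls X n (φ' n x) := fun n x =>
    DFinsupp.mapRange_single (hf := fun n => map_zero (φ n))
  have hμ : D.mulMap.compr₂ Φ.toLinearMap
      = (GrEnv.mulMap X).compl₁₂ Φ.toLinearMap Φ.toLinearMap := by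
    refine D.hom_ext₂ fun i j a b => ?_
    change Φ (D.mulMap (D.of i a) (D.of j b)) = GrEnv.mulMap X (Φ (D.of i a)) (Φ (D.of j b))
    rw [hΦ, hΦ, GrEnv.mulMap_cls]
    obtain ⟨x, hx⟩ := D.mul_mem_degree (i := i) (j := j) ⟨a, rfl⟩ ⟨b, rfl⟩
    rw [← hx, hΦ]
    refine GrEnv.cls_eq_cls_of_sub_mem _ _ _ ?_
    change ψ (D.of (i + j) x) - Env.mulMap X (ψ (D.of i a)) (ψ (D.of j b)) ∈ _
    -- The difference of the two representatives is minus the image of the correction.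
    rw [← ψμ, hx, map_add, sub_add_cancel_left]
    refine neg_mem ?_
    -- In total degree 0 the previous step is zero, so the correction itself has to vanish.
    rcases Nat.eq_zero_or_pos (i + j) with h | h
    · rw [hc.eq_zero i j a b (Or.inl (by omega)), map_zero]
      exact zero_mem _
    · obtain ⟨n, hn⟩ := Nat.exists_eq_add_of_le' h
      rw [hn]
      exact (mem_iff n _).2 (hc.mem_filtration i j n a b hn)
  refine ⟨Φ, fun a b => LinearMap.congr_fun₂ hμ a b, ?_, fun n => ?_, fun γ => ?_, fun m => ?_⟩
  · exact (hΦ 0 _).trans (congrArg _ (Subtype.ext ψ0))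
  · refine le_antisymm ?_ ?_
    · rintro _ ⟨_, ⟨x, rfl⟩, rfl⟩
      exact ⟨φ n x, (hΦ n x).symm⟩
    · rintro _ ⟨y, rfl⟩
      obtain ⟨x, rfl⟩ := (hbij n).2 y
      exact ⟨D.of n x, ⟨x, rfl⟩, hΦ n x⟩
  · refine le_antisymm ?_ ?_
    · rw [Submodule.map_le_iff_le_comap]
      refine iSup_le fun n => ?_
      rintro _ ⟨x, hx, rfl⟩
      refine Submodule.mem_iSup_of_mem n ⟨φ' n x, ?_, (hΦ n x).symm⟩
      have : ψ (D.of n x) ∈ Env.parity X γ := by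
        rw [← ψpar γ]
        exact ⟨_, D.of_mem_parity hx, rfl⟩
      exact this
    · refine iSup_le fun n => ?_
      rintro _ ⟨⟨a, ha⟩, hγ, rfl⟩
      have hγ' : a ∈ Env.parity X γ := hγ
      rw [← ψpar γ] at hγ'
      obtain ⟨v, hv, rfl⟩ := hγ'
      -- The preimage `v` has parity `γ` but need not be homogeneous in degree; its component of
      -- degree `n` keeps the parity and has the same class.
      refine ⟨D.of n (DirectSum.component K ℕ (fun n => (D.level n : Type _)) n v),
        D.of_mem_parity (D.component_mem_levelPar hv n), ?_⟩
      exact (hΦ n _).trans (hsurj n v ha).symm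
  · exact (hΦ 1 _).trans (congrArg _ (Subtype.ext (ψ1 m)))

end AkivisSuperalgebra

end

end AkivisSuper

theorem mainTheorem1 {K : Type u} {M : Type v} [Field K] [AddCommGroup M] [Module K M]
    (h2 : (2 : K) ≠ 0) (h3 : (3 : K) ≠ 0) (X : AkivisSuperalgebra K M) :
    (∃ Φ : V X.gr ≃ₗ[K] X.GrEnv,
      (∀ a b, Φ ((symData X.gr).mulMap a b) = AkivisSuperalgebra.GrEnv.mulMap X (Φ a) (Φ b)) ∧
      Φ (symData X.gr).one = AkivisSuperalgebra.GrEnv.one X ∧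
      (∀ n : ℕ, ((symData X.gr).degree n).map Φ.toLinearMap
        = AkivisSuperalgebra.GrEnv.degree X n) ∧
      (∀ γ : ZMod 2, ((symData X.gr).parity γ).map Φ.toLinearMap
        = AkivisSuperalgebra.GrEnv.parity X γ) ∧
      ∀ m : M, Φ (V.ι X.gr m) = AkivisSuperalgebra.GrEnv.ι X m) ∧
    (∃ Ψ : V X.gr ≃ₗ[K] X.trivial.Env,
      (∀ a b, Ψ ((symData X.gr).mulMap a b)
        = AkivisSuperalgebra.Env.mulMap X.trivial (Ψ a) (Ψ b)) ∧
      Ψ (symData X.gr).one = AkivisSuperalgebra.Env.one X.trivial ∧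
      (∀ n : ℕ, ((symData X.gr).degree n).map Ψ.toLinearMap
        = AkivisSuperalgebra.Env.degree X.trivial n) ∧
      (∀ γ : ZMod 2, ((symData X.gr).parity γ).map Ψ.toLinearMap
        = AkivisSuperalgebra.Env.parity X.trivial γ) ∧
      ∀ m : M, Ψ (V.ι X.gr m) = AkivisSuperalgebra.Env.ι X.trivial m) := by
  refine ⟨?_, ?_⟩
  · obtain ⟨c, hc⟩ := X.exists_isCorrection h2 h3
    exact hc.exists_grEquiv h2
  -- For the trivial structure the zero correction is admissible, so the product of `V(M)` needs no
  -- deformation and the stronger statement on degrees is available.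
  · obtain ⟨ψ, ψ0, ψ1, ψμ, -, ψdeg, ψpar⟩ := X.isCorrection_zero.exists_equiv h2
    refine ⟨ψ, fun a b => ?_, ψ0, ψdeg rfl rfl, ψpar, ψ1⟩
    exact (congrArg ψ (add_zero ((symData X.gr).mulMap a b)).symm).trans (ψμ a b)
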